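/- Let $d\ge 1$ and let $\Omega\subset\mathbb{R}^d$ be a bounded convex body, i.e. a bounded closed convex set with non-empty interior. Let $P(D)=D^2+pD+q$ with arbitrary constants $p,q\in\mathbb{R}$, and let $W^{P(D)}_\infty(\Omega)$ be the set of all $f\in C^1(\Omega)$ such that for every unit vector $u\in\mathbb{R}^d$ the generalized (weak) derivative $\partial^2 f/\partial u^2$ exists inside $\Omega$ as a locally integrable function and $$\Big\|\frac{\partial^2 f}{\partial u^2}+p\,\frac{\partial f}{\partial u}+q f\Big\|_\infty\le 1,$$ where $\|\cdot\|_\infty$ is the essential supremum norm on $\Omega$. For a finite set $\xi\subset\Omega$ let $I_\xi(f)=(f(x),\nabla f(x))_{x\in\xi}$, and define the $n$-th optimal recovery error $$R_n(W^{P(D)}_\infty(\Omega))=\inf_{\xi\subset\Omega,\ \mathrm{card}\,\xi\le n}\ \inf_{\phi}\ \sup_{f\in W^{P(D)}_\infty(\Omega)}\|f-\phi(I_\xi(f))\|_\infty ,$$ the inner infimum being over all mappings $\phi$ (algorithms) from the information $I_\xi(f)$ to $C(\Omega)$. Then $$R_n(W^{P(D)}_\infty(\Omega))\ \le\ \frac14\left(\frac{\mathrm{dens}(d)\,\mu_d(\Omega)}{\nu_d\,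 n}\right)^{2/d}(1+o(1))\qquad (n\to\infty).$$ Here $\mu_d$ is Lebesgue measure, $\nu_d$ is the volume of the unit ball of $\mathbb{R}^d$, and $$\mathrm{dens}(d)=\inf_{\mathcal M}\ \liminf_{R\to\infty}\frac{\sum_{B\in\mathcal M}\mu_d(B\cap[-R,R]^d)}{\mu_d([-R,R]^d)}$$ is the least density of sphere coverings, the infimum being over all countable collections $\mathcal M$ of balls of one common radius whose union is $\mathbb{R}^d$. In particular the leading constant does not depend on $p$ or $q$. -/

import Mathlib

open MeasureTheory Filter Topology
open scoped ENNReal ContDiff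

namespace OptRecovery

/-- `ℝ^d` with the Euclidean norm. -/
abbrev E (d : ℕ) : Type := EuclideanSpace ℝ (Fin d)

/-! ### Sphere coverings of `ℝ^d` -/

/-- The cube `[-R, R]^d`. -/
def cube (d : ℕ) (R : ℝ) : Set (E d) := {x | ∀ i, x i ∈ Set.Icc (-R) R}

/-- The density of the family of closed balls of radius `r` centred at the points of `C`:
the lower limit, as `R → ∞`, of `(∑ vol (B ∩ [-R,R]^d)) / vol [-R,R]^d`. -/
noncomputable def coverDensity (d : ℕ) (r : ℝ) (C : Set (E d)) : ℝ≥0∞ :=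
  liminf (fun R : ℝ =>
    (∑' c : C, volume (Metric.closedBall (c : E d) r ∩ cube d R)) / volume (cube d R)) atTop

/-- `dens(d)`: the least density of a covering of `ℝ^d` by countably many balls
of one common radius. -/
noncomputable def dens (d : ℕ) : ℝ≥0∞ :=
  ⨅ (r : ℝ) (C : Set (E d)) (_ : 0 < r) (_ : C.Countable)
    (_ : (⋃ c ∈ C, Metric.closedBall c r) = Set.univ), coverDensity d r C

/-! ### The function class -/

/-- `w` is the generalized (weak) second derivative `∂²f/∂u²` of `f` inside `Ω`. -/
def IsWeakSecondDeriv {d : ℕ} (Ω : Set (E d)) (u : E d) (f w : E d → ℝ) : Prop :=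
  LocallyIntegrableOn w (interior Ω) ∧
  ∀ φ : E d → ℝ, ContDiff ℝ ∞ φ → HasCompactSupport φ → tsupport φ ⊆ interior Ω →
    ∫ x in Ω, f x * lineDeriv ℝ (fun y => lineDeriv ℝ φ y u) x u = ∫ x in Ω, w x * φ x

/-- The class of all `f ∈ C¹(Ω)` such that, for every unit vector `u`, the generalized derivative
`∂²f/∂u²` exists inside `Ω` and `‖∂²f/∂u² + p ∂f/∂u + q f‖_∞ ≤ 1`.
Functions on `Ω` are represented by functions on the whole space, whose values outside `Ω`
are irrelevant. -/
def classW {d : ℕ} (p q : ℝ) (Ω : Set (E d)) : Set (E d → ℝ) :=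
  {f | ContDiffOn ℝ 1 f Ω ∧
    ∀ u : E d, ‖u‖ = 1 → ∃ w : E d → ℝ, IsWeakSecondDeriv Ω u f w ∧
      eLpNorm (fun x => w x + p * inner ℝ (gradientWithin f Ω x) u + q * f x) ∞
        (volume.restrict Ω) ≤ 1}

/-! ### Optimal recovery -/

/-- The information operator `f ↦ (f(x), ∇f(x))_{x ∈ ξ}`. -/
noncomputable def info {d : ℕ} (Ω : Set (E d)) (ξ : Finset (E d)) (f : E d → ℝ) :
    ξ → ℝ × E d :=
  fun x => (f x, gradientWithin f Ω x)

/-- The worst-case error over the class `W` of the algorithm `A`, which sends the information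
at the nodes `ξ` to a continuous function on `Ω`. -/
noncomputable def algError {d : ℕ} (Ω : Set (E d)) (W : Set (E d → ℝ)) (ξ : Finset (E d))
    (A : (ξ → ℝ × E d) → C(Ω, ℝ)) : ℝ≥0∞ :=
  ⨆ f ∈ W, eLpNorm (fun x : Ω => f x - A (info Ω ξ f) x) ∞ (volume.comap (Subtype.val : Ω → E d))

/-- The optimal error over `W` for the nodes `ξ`: infimum over all algorithms. -/
noncomputable def nodeError {d : ℕ} (Ω : Set (E d)) (W : Set (E d → ℝ)) (ξ : Finset (E d)) :
    ℝ≥0∞ :=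
  ⨅ A : (ξ → ℝ × E d) → C(Ω, ℝ), algError Ω W ξ A

/-- The `n`-th optimal error over `W`: infimum over all sets of at most `n` nodes in `Ω`. -/
noncomputable def optError {d : ℕ} (Ω : Set (E d)) (W : Set (E d → ℝ)) (n : ℕ) : ℝ≥0∞ :=
  ⨅ (ξ : Finset (E d)) (_ : (ξ : Set (E d)) ⊆ Ω) (_ : ξ.card ≤ n), nodeError Ω W ξ

end OptRecovery

/-!
The class does not depend on `p` in any way that matters here: averaging the constraints for the
directions `u` and `-u` removes the first order term, so `|∂²f/∂u² + q f| ≤ 1` for every unit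
vector `u` (`exists_weakSecondDeriv_add_mul_le`). If moreover `|f| ≤ M` on `Ω`, the weak second
derivatives are bounded by `L = 1 + |q| M`, and smoothing `f` turns this into the pointwise Taylor
estimate `|f y - f x - ⟨∇f x, y - x⟩| ≤ L/2 · ‖y - x‖²` on all of `Ω` (`abs_sub_taylor_le`).

Let `f` in the class have vanishing information at nodes that are `ε`-dense in `Ω` and `ε/√2`-dense
on the boundary, and let `|f|` attain its maximum `M` at `x₀`. If `x₀` is interior then
`∇f x₀ = 0`, and the Taylor estimates from `x₀` and from a node within `ε` meet at the midpoint,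
giving `M ≤ L ε²/4`; this is where the constant `1/4`, instead of `1/2`, comes from. If `x₀` is on
the boundary, the estimate from a node within `ε/√2` gives the same. Hence
`M ≤ (ε²/4) / (1 - |q| ε²/4)` (`abs_le_of_info_eq_zero`). Two members of the class with equal
information have half their difference in the class, so their distance is at most twice this
bound; since they are uniformly Lipschitz relative to each other, the mean of the upper and lower
envelopes of all members with the given information is continuous, and it is an algorithm that
attains the bound (`nodeError_le`).

It remains to count nodes (`eventually_exists_nodes`). A covering of nearly minimal density gives a
covering of one large cube by unit balls with about `dens(d)` times the volume of the cube divided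
by `ν_d` balls; scaled copies of it on a grid of cubes cover `Ω` with about
`dens(d) μ(Ω) / (ν_d εᵈ)` balls of radius `ε`, whose centres may be projected onto `Ω`. The
boundary of a convex set is null, so its net needs only `o(ε⁻ᵈ)` points. Choosing `ε` so that the
total is `n` gives the theorem.
-/

namespace OptRecovery

/-! ### Second order estimates from a weak second derivative -/

/-- A function on `[0, 1]` with `|G''| ≤ K` deviates from its chord by at most `K/2 · s (1 - s)`,
because `K t² / 2 ± G` are convex. -/
theorem abs_sub_chord_le {G G' G'' : ℝ → ℝ} {K : ℝ}
    (h1 : ∀ t, HasDerivAt G (G' t) t) (h2 : ∀ t, HasDerivAt G' (G'' t) t)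
    (hK : ∀ t ∈ Set.Icc (0 : ℝ) 1, |G'' t| ≤ K) {s : ℝ} (hs : s ∈ Set.Icc (0 : ℝ) 1) :
    |G s - ((1 - s) * G 0 + s * G 1)| ≤ K / 2 * (s * (1 - s)) := by
  have q1 : ∀ t : ℝ, HasDerivAt (fun t : ℝ => K / 2 * t ^ 2) (K * t) t := fun t => by
    have := (hasDerivAt_pow 2 t).const_mul (K / 2)
    simpa [← mul_assoc] using this
  have q2 : ∀ t : ℝ, HasDerivAt (fun t : ℝ => K * t) K t := fun t => by
    simpa using (hasDerivAt_id t).const_mul K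
  have hsub : interior (Set.Icc (0 : ℝ) 1) ⊆ Set.Icc 0 1 := interior_subset
  have cvx_add : ConvexOn ℝ (Set.Icc (0 : ℝ) 1) (fun t => K / 2 * t ^ 2 + G t) :=
    convexOn_of_hasDerivWithinAt2_nonneg (convex_Icc 0 1)
      (fun t _ => ((q1 t).add (h1 t)).continuousAt.continuousWithinAt)
      (fun t _ => ((q1 t).add (h1 t)).hasDerivWithinAt)
      (fun t _ => ((q2 t).add (h2 t)).hasDerivWithinAt)
      (fun t ht => by linarith [(abs_le.1 (hK t (hsub ht))).1])
  have cvx_sub : ConvexOn ℝ (Set.Icc (0 : ℝ) 1) (fun t => K / 2 * t ^ 2 - G t) :=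
    convexOn_of_hasDerivWithinAt2_nonneg (convex_Icc 0 1)
      (fun t _ => ((q1 t).sub (h1 t)).continuousAt.continuousWithinAt)
      (fun t _ => ((q1 t).sub (h1 t)).hasDerivWithinAt)
      (fun t _ => ((q2 t).sub (h2 t)).hasDerivWithinAt)
      (fun t ht => by linarith [(abs_le.1 (hK t (hsub ht))).2])
  have m0 : (0 : ℝ) ∈ Set.Icc (0 : ℝ) 1 := by simp
  have m1 : (1 : ℝ) ∈ Set.Icc (0 : ℝ) 1 := by simp
  have e1 := cvx_add.2 m0 m1 (sub_nonneg.2 hs.2) hs.1 (by ring)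
  have e2 := cvx_sub.2 m0 m1 (sub_nonneg.2 hs.2) hs.1 (by ring)
  simp only [smul_eq_mul, mul_zero, mul_one, zero_add] at e1 e2
  rw [abs_le]
  constructor <;> nlinarith

theorem lineDeriv_eq_fderiv_of_contDiff {d : ℕ} {ψ : E d → ℝ} (h : ContDiff ℝ ∞ ψ) (u : E d) :
    (fun y => lineDeriv ℝ ψ y u) = fun y => fderiv ℝ ψ y u := by
  funext y
  exact ((h.differentiable (by simp)) y).lineDeriv_eq_fderiv

theorem contDiff_lineDeriv {d : ℕ} {ψ : E d → ℝ} (h : ContDiff ℝ ∞ ψ) (u : E d) :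
    ContDiff ℝ ∞ (fun y => lineDeriv ℝ ψ y u) := by
  rw [lineDeriv_eq_fderiv_of_contDiff h]
  exact (h.fderiv_right (m := ∞) (by simp)).clm_apply contDiff_const

theorem hasCompactSupport_lineDeriv {d : ℕ} {ψ : E d → ℝ} (h : ContDiff ℝ ∞ ψ)
    (hc : HasCompactSupport ψ) (u : E d) :
    HasCompactSupport (fun y => lineDeriv ℝ ψ y u) := by
  rw [lineDeriv_eq_fderiv_of_contDiff h]
  exact hc.fderiv_apply ℝ u

/-- Differentiation under the integral sign: the restriction of a smoothing of `f` to a line is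
differentiable, and the derivative falls on the smoothing kernel `ψ`. -/
theorem hasDerivAt_smoothing {d : ℕ} {Ω : Set (E d)} {f ψ : E d → ℝ} (hf : IntegrableOn f Ω)
    (hψ : ContDiff ℝ ∞ ψ) (hc : HasCompactSupport ψ) (x v : E d) (t : ℝ) :
    HasDerivAt (fun t : ℝ => ∫ y in Ω, f y * ψ (x + t • v - y))
      (∫ y in Ω, f y * lineDeriv ℝ ψ (x + t • v - y) v) t := by
  have hψ' := contDiff_lineDeriv hψ v
  obtain ⟨B, hB⟩ := hc.exists_bound_of_continuous hψ.continuous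
  obtain ⟨B', hB'⟩ := (hasCompactSupport_lineDeriv hψ hc v).exists_bound_of_continuous
    hψ'.continuous
  have meas : ∀ (χ : E d → ℝ) (_ : Continuous χ) (t : ℝ),
      AEStronglyMeasurable (fun y => f y * χ (x + t • v - y)) (volume.restrict Ω) := by
    intro χ hχ t
    exact hf.aestronglyMeasurable.mul (by fun_prop : Continuous _).aestronglyMeasurable
  refine (hasDerivAt_integral_of_dominated_loc_of_deriv_le (μ := volume.restrict Ω) (𝕜 := ℝ)
    (F := fun t y => f y * ψ (x + t • v - y))
    (F' := fun t y => f y * lineDeriv ℝ ψ (x + t • v - y) v)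
    (bound := fun y => ‖f y‖ * B') (s := Set.univ) univ_mem
    (Eventually.of_forall fun t => meas ψ hψ.continuous t) ?_
    (meas _ hψ'.continuous t) ?_ (hf.norm.mul_const _) ?_).2
  · exact Integrable.mul_bdd hf (by
      have := hψ.continuous
      exact (by fun_prop : Continuous fun y => ψ (x + t • v - y)).aestronglyMeasurable)
      (Eventually.of_forall fun y => hB _)
  · refine Eventually.of_forall fun y t _ => ?_
    rw [norm_mul]
    exact mul_le_mul_of_nonneg_left (hB' _) (norm_nonneg _)
  · refine Eventually.of_forall fun y t _ => ?_
    refine HasDerivAt.const_mul (f y) ?_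
    have hd : HasFDerivAt ψ (fderiv ℝ ψ (x + t • v - y)) (x + t • v - y) :=
      ((hψ.differentiable (by simp)) _).hasFDerivAt
    have hl : HasDerivAt (fun t : ℝ => x + t • v - y) v t := by
      have := (((hasDerivAt_id t).smul_const v).const_add x).sub_const y
      simpa using this
    have := hd.comp_hasDerivAt t hl
    rw [show lineDeriv ℝ ψ (x + t • v - y) v = fderiv ℝ ψ (x + t • v - y) v from
      ((hψ.differentiable (by simp)) _).lineDeriv_eq_fderiv]
    exact this

theorem lineDeriv_comp_const_sub {d : ℕ} (ψ : E d → ℝ) (z u y : E d) :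
    lineDeriv ℝ (fun y => ψ (z - y)) y u = -lineDeriv ℝ ψ (z - y) u := by
  have h : lineDeriv ℝ (fun y => ψ (z - y)) y u = lineDeriv ℝ ψ (z - y) (-u) := by
    have e : (fun t : ℝ => ψ (z - (y + t • u))) = fun t : ℝ => ψ (z - y + t • -u) := by
      funext t
      congr 1
      module
    exact congrArg (fun g : ℝ → ℝ => deriv g 0) e
  rw [h, lineDeriv_neg]

/-- Integrating `f` against the second derivative of a normalized bump at `z` costs at most the
bound on the weak second derivative of `f`. -/
theorem abs_integral_lineDeriv_lineDeriv_bump_le {d : ℕ} {Ω : Set (E d)} {u : E d}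
    {f w : E d → ℝ} {L : ℝ} (hL : 0 ≤ L)
    (hw : IsWeakSecondDeriv Ω u f w) (hbound : ∀ᵐ y ∂(volume.restrict Ω), |w y| ≤ L)
    (η : ContDiffBump (0 : E d)) {z : E d} (hz : Metric.closedBall z η.rOut ⊆ interior Ω) :
    |∫ y in Ω, f y * lineDeriv ℝ (fun y => lineDeriv ℝ (η.normed volume) y u) (z - y) u| ≤ L := by
  set ψ := η.normed volume with hψdef
  have hψ : ContDiff ℝ ∞ ψ := η.contDiff_normed
  have hcψ : HasCompactSupport ψ := η.hasCompactSupport_normed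
  set φ : E d → ℝ := fun y => ψ (z - y) with hφ
  have hφsupp : tsupport φ ⊆ Metric.closedBall z η.rOut := by
    refine closure_minimal ?_ Metric.isClosed_closedBall
    intro y hy
    have : z - y ∈ tsupport ψ := subset_tsupport _ hy
    rw [hψdef, η.tsupport_normed_eq] at this
    rw [Metric.mem_closedBall, dist_comm, dist_eq_norm]
    simpa using this
  have hφc : HasCompactSupport φ :=
    HasCompactSupport.of_support_subset_isCompact (isCompact_closedBall z η.rOut)
      ((subset_tsupport _).trans hφsupp)
  have hφd : ContDiff ℝ ∞ φ := hψ.comp (contDiff_const.sub contDiff_id)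
  have key := hw.2 φ hφd hφc (hφsupp.trans hz)
  have e : ∀ y, lineDeriv ℝ (fun y => lineDeriv ℝ φ y u) y u =
      lineDeriv ℝ (fun y => lineDeriv ℝ ψ y u) (z - y) u := by
    intro y
    have e1 : (fun y => lineDeriv ℝ φ y u) =
        fun y => (fun x => -lineDeriv ℝ ψ x u) (z - y) := by
      funext y
      exact lineDeriv_comp_const_sub ψ z u y
    rw [e1, lineDeriv_comp_const_sub (fun x => -lineDeriv ℝ ψ x u)]
    have d1 : DifferentiableAt ℝ (fun y => lineDeriv ℝ ψ y u) (z - y) :=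
      ((contDiff_lineDeriv hψ u).differentiable (by simp)) _
    rw [d1.lineDeriv_eq_fderiv, d1.fun_neg.lineDeriv_eq_fderiv, fderiv_fun_neg]
    simp
  simp_rw [e] at key
  rw [key]
  have hφint : Integrable φ := hφd.continuous.integrable_of_hasCompactSupport hφc
  have hφnn : ∀ y, 0 ≤ φ y := fun y => η.nonneg_normed _
  have tot : ∫ y, φ y = 1 := by
    have := integral_sub_left_eq_self ψ volume z
    rw [hφ, this]
    exact η.integral_normed
  calc |∫ y in Ω, w y * φ y| ≤ ∫ y in Ω, L * φ y := by
        refine norm_integral_le_of_norm_le (f := fun y => w y * φ y) (hφint.integrableOn.const_mul L) ?_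
        filter_upwards [hbound] with y hy
        rw [norm_mul, Real.norm_eq_abs, Real.norm_eq_abs, abs_of_nonneg (hφnn y)]
        exact mul_le_mul_of_nonneg_right hy (hφnn y)
    _ = L * ∫ y in Ω, φ y := by rw [integral_const_mul]
    _ ≤ L * ∫ y, φ y :=
        mul_le_mul_of_nonneg_left
          (setIntegral_le_integral hφint (Eventually.of_forall hφnn)) hL
    _ = L := by rw [tot, mul_one]

theorem abs_smoothing_sub_le {d : ℕ} {Ω : Set (E d)} (hΩ : MeasurableSet Ω) {f : E d → ℝ}
    (hf : IntegrableOn f Ω) (η : ContDiffBump (0 : E d)) {z : E d} {ε : ℝ}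
    (hz : z ∈ Ω) (hball : ∀ y ∈ Metric.ball z η.rOut, y ∈ Ω ∧ |f y - f z| ≤ ε) :
    |(∫ y in Ω, f y * η.normed volume (z - y)) - f z| ≤ ε := by
  have h := ContDiffBump.dist_normed_convolution_le (φ := η) (μ := volume) (x₀ := z) (ε := ε)
    (g := Ω.indicator f) ((aestronglyMeasurable_indicator_iff hΩ).2 hf.aestronglyMeasurable) (fun y hy => by
      rw [Set.indicator_of_mem (hball y hy).1, Set.indicator_of_mem hz]
      exact (hball y hy).2)
  rw [convolution_lsmul_swap, Set.indicator_of_mem hz, Real.dist_eq] at h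
  convert h using 3
  rw [← integral_indicator hΩ]
  congr 1
  funext y
  by_cases hy : y ∈ Ω <;> simp [hy, mul_comm]

/-- The chord estimate along segments in the interior, obtained by smoothing `f` at a scale that
tends to zero. -/
theorem abs_sub_chord_le_of_mem_interior {d : ℕ} {Ω : Set (E d)} (hconv : Convex ℝ Ω)
    (hcomp : IsCompact Ω) {f : E d → ℝ} (hf : ContinuousOn f Ω) {L : ℝ} (hL : 0 ≤ L)
    (hweak : ∀ u : E d, ‖u‖ = 1 → ∃ w, IsWeakSecondDeriv Ω u f w ∧
      ∀ᵐ y ∂(volume.restrict Ω), |w y| ≤ L)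
    {x y : E d} (hx : x ∈ interior Ω) (hy : y ∈ interior Ω) {s : ℝ}
    (hs : s ∈ Set.Icc (0 : ℝ) 1) :
    |f (x + s • (y - x)) - ((1 - s) * f x + s * f y)| ≤
      L / 2 * ‖y - x‖ ^ 2 * (s * (1 - s)) := by
  rcases eq_or_ne x y with rfl | hne
  · simp only [sub_self, smul_zero, add_zero, norm_zero]
    rw [show f x - ((1 - s) * f x + s * f x) = 0 by ring]
    simp
  set v := y - x with hv
  have hvpos : 0 < ‖v‖ := norm_pos_iff.2 (sub_ne_zero.2 hne.symm)
  set u := ‖v‖⁻¹ • v with hu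
  have hu1 : ‖u‖ = 1 := by
    rw [hu, norm_smul, norm_inv, norm_norm, inv_mul_cancel₀ hvpos.ne']
  have hvu : v = ‖v‖ • u := by
    rw [hu, smul_smul, mul_inv_cancel₀ hvpos.ne', one_smul]
  obtain ⟨w, hw, hwb⟩ := hweak u hu1
  have hfi : IntegrableOn f Ω := hf.integrableOn_compact hcomp
  have hseg : ∀ t ∈ Set.Icc (0 : ℝ) 1, x + t • v ∈ interior Ω := by
    intro t ht
    exact hconv.interior.add_smul_sub_mem hx hy ht
  obtain ⟨δ₀, hδ₀, hthick⟩ := IsCompact.exists_cthickening_subset_open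
    (s := (fun t : ℝ => x + t • v) '' Set.Icc 0 1) (t := interior Ω)
    (isCompact_Icc.image (by fun_prop)) isOpen_interior (by
      rintro _ ⟨t, ht, rfl⟩
      exact hseg t ht)
  refine le_of_forall_pos_le_add fun ε hε => ?_
  have hcont : ∀ z ∈ interior Ω, ∃ δ > 0, ∀ y ∈ Metric.ball z δ, y ∈ Ω ∧ |f y - f z| ≤ ε / 2 := by
    intro z hz
    have hΩz : Ω ∈ 𝓝 z := mem_interior_iff_mem_nhds.1 hz
    have hev : ∀ᶠ y in 𝓝 z, y ∈ Ω ∧ |f y - f z| ≤ ε / 2 := by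
      filter_upwards [hΩz, Metric.tendsto_nhds.1 (hf.continuousAt hΩz) (ε / 2) (half_pos hε)]
        with y h1 h2
      exact ⟨h1, by rw [← Real.dist_eq]; exact h2.le⟩
    obtain ⟨δ, hδ, h⟩ := Metric.eventually_nhds_iff_ball.1 hev
    exact ⟨δ, hδ, h⟩
  have m0 : (0 : ℝ) ∈ Set.Icc (0 : ℝ) 1 := by simp
  have m1 : (1 : ℝ) ∈ Set.Icc (0 : ℝ) 1 := by simp
  obtain ⟨δ₁, p₁, h₁⟩ := hcont _ (hseg 0 m0)
  obtain ⟨δ₂, p₂, h₂⟩ := hcont _ (hseg 1 m1)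
  obtain ⟨δ₃, p₃, h₃⟩ := hcont _ (hseg s hs)
  set δ := min δ₀ (min δ₁ (min δ₂ δ₃)) with hδ
  have hδpos : 0 < δ := by positivity
  let η : ContDiffBump (0 : E d) := ⟨δ / 2, δ, half_pos hδpos, half_lt_self hδpos⟩
  have hηout : η.rOut = δ := rfl
  set ψ := η.normed volume with hψdef
  have hψ : ContDiff ℝ ∞ ψ := η.contDiff_normed
  have hcψ : HasCompactSupport ψ := η.hasCompactSupport_normed
  have approx : ∀ t ∈ Set.Icc (0 : ℝ) 1, ∀ δ', δ ≤ δ' →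
      (∀ y ∈ Metric.ball (x + t • v) δ', y ∈ Ω ∧ |f y - f (x + t • v)| ≤ ε / 2) →
      |(∫ y in Ω, f y * ψ (x + t • v - y)) - f (x + t • v)| ≤ ε / 2 := by
    intro t ht δ' hle hb
    exact abs_smoothing_sub_le hcomp.isClosed.measurableSet hfi η
      (interior_subset (hseg t ht)) fun y hy => hb y (Metric.ball_subset_ball hle hy)
  have a0 := approx 0 m0 δ₁ (by simp [hδ]) h₁
  have a1 := approx 1 m1 δ₂ (by simp [hδ]) h₂
  have as := approx s hs δ₃ (by simp [hδ]) h₃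
  have key := abs_sub_chord_le (K := L * ‖v‖ ^ 2)
    (hasDerivAt_smoothing hfi hψ hcψ x v)
    (hasDerivAt_smoothing hfi (contDiff_lineDeriv hψ v)
      (hasCompactSupport_lineDeriv hψ hcψ v) x v) (by
    intro t ht
    have hsub : Metric.closedBall (x + t • v) η.rOut ⊆ interior Ω := by
      refine Set.Subset.trans ?_ hthick
      refine Set.Subset.trans (Metric.closedBall_subset_closedBall (min_le_left _ _ : δ ≤ δ₀)) ?_
      exact Metric.closedBall_subset_cthickening
        (Set.mem_image_of_mem (fun t : ℝ => x + t • v) ht) δ₀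
    have e : ∀ z, lineDeriv ℝ (fun y => lineDeriv ℝ ψ y v) z v =
        ‖v‖ ^ 2 * lineDeriv ℝ (fun y => lineDeriv ℝ ψ y u) z u := by
      intro z
      have e1 : (fun y => lineDeriv ℝ ψ y v) = fun y => ‖v‖ * lineDeriv ℝ ψ y u := by
        funext y
        conv_lhs => rw [hvu]
        rw [lineDeriv_smul, smul_eq_mul]
      have d1 : DifferentiableAt ℝ (fun y => lineDeriv ℝ ψ y u) z :=
        ((contDiff_lineDeriv hψ u).differentiable (by simp)) _
      rw [e1]
      conv_lhs => rw [hvu]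
      rw [lineDeriv_smul, (d1.const_mul _).lineDeriv_eq_fderiv, d1.lineDeriv_eq_fderiv,
        fderiv_const_mul d1]
      rw [norm_smul, norm_norm, hu1]
      simp [pow_two, mul_assoc]
    simp_rw [e]
    have := abs_integral_lineDeriv_lineDeriv_bump_le hL hw hwb η hsub
    rw [show (fun y => f y * (‖v‖ ^ 2 * lineDeriv ℝ (fun y => lineDeriv ℝ ψ y u)
      (x + t • v - y) u)) = fun y => ‖v‖ ^ 2 * (f y * lineDeriv ℝ (fun y => lineDeriv ℝ ψ y u)
      (x + t • v - y) u) by funext y; ring, integral_const_mul, abs_mul, abs_of_nonneg (by positivity),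
      mul_comm L]
    exact mul_le_mul_of_nonneg_left this (by positivity)) hs
  have y0 : x + (0 : ℝ) • v = x := by simp
  have y1 : x + (1 : ℝ) • v = y := by simp [hv]
  simp only [y0, y1] at a0 a1 key
  have hs0 := hs.1
  have hs1 := hs.2
  rw [abs_le] at a0 a1 as key ⊢
  have b0 := mul_le_mul_of_nonneg_left a0.1 (sub_nonneg.2 hs1)
  have b0' := mul_le_mul_of_nonneg_left a0.2 (sub_nonneg.2 hs1)
  have b1 := mul_le_mul_of_nonneg_left a1.1 hs0
  have b1' := mul_le_mul_of_nonneg_left a1.2 hs0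
  constructor <;> nlinarith

theorem abs_sub_chord_le_of_mem {d : ℕ} {Ω : Set (E d)} (hconv : Convex ℝ Ω)
    (hcomp : IsCompact Ω) (hint : (interior Ω).Nonempty) {f : E d → ℝ} (hf : ContinuousOn f Ω)
    {L : ℝ} (hL : 0 ≤ L)
    (hweak : ∀ u : E d, ‖u‖ = 1 → ∃ w, IsWeakSecondDeriv Ω u f w ∧
      ∀ᵐ y ∂(volume.restrict Ω), |w y| ≤ L)
    {x y : E d} (hx : x ∈ Ω) (hy : y ∈ Ω) {s : ℝ} (hs : s ∈ Set.Icc (0 : ℝ) 1) :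
    |f (x + s • (y - x)) - ((1 - s) * f x + s * f y)| ≤
      L / 2 * ‖y - x‖ ^ 2 * (s * (1 - s)) := by
  obtain ⟨c, hc⟩ := hint
  -- Contract the segment towards the interior point `c` and let the contraction tend to the
  -- identity.
  have hin : ∀ z ∈ Ω, ∀ᶠ t : ℝ in 𝓝[>] 0, z + t • (c - z) ∈ interior Ω := by
    intro z hz
    filter_upwards [Ioo_mem_nhdsGT (zero_lt_one' ℝ)] with t ht
    have := hconv.combo_self_interior_mem_interior hz hc (sub_nonneg.2 ht.2.le) ht.1 (by ring)
    convert this using 1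
    module
  have hlim : ∀ z ∈ Ω, Tendsto (fun t : ℝ => f (z + t • (c - z))) (𝓝[>] 0) (𝓝 (f z)) := by
    intro z hz
    refine (hf z hz).tendsto.comp (tendsto_nhdsWithin_iff.2 ⟨?_, ?_⟩)
    · have : Tendsto (fun t : ℝ => z + t • (c - z)) (𝓝 0) (𝓝 (z + (0 : ℝ) • (c - z))) :=
        Continuous.tendsto (by fun_prop) 0
      simpa using this.mono_left nhdsWithin_le_nhds
    · filter_upwards [hin z hz] with t ht using interior_subset ht
  have hm : x + s • (y - x) ∈ Ω := hconv.add_smul_sub_mem hx hy hs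
  have l1 := ((hlim _ hm).sub (((hlim x hx).const_mul (1 - s)).add ((hlim y hy).const_mul s))).abs
  have l2 : Tendsto (fun t : ℝ => L / 2 * ‖(y + t • (c - y)) - (x + t • (c - x))‖ ^ 2 *
      (s * (1 - s))) (𝓝[>] 0) (𝓝 (L / 2 * ‖y - x‖ ^ 2 * (s * (1 - s)))) := by
    have : Tendsto (fun t : ℝ => L / 2 * ‖(y + t • (c - y)) - (x + t • (c - x))‖ ^ 2 *
      (s * (1 - s))) (𝓝 0) (𝓝 (L / 2 * ‖(y + (0 : ℝ) • (c - y)) - (x + (0 : ℝ) • (c - x))‖ ^ 2 *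
      (s * (1 - s)))) := Continuous.tendsto (by fun_prop) 0
    simpa using this.mono_left nhdsWithin_le_nhds
  refine le_of_tendsto_of_tendsto l1 l2 ?_
  filter_upwards [hin x hx, hin y hy] with t htx hty
  have := abs_sub_chord_le_of_mem_interior hconv hcomp hf hL hweak htx hty hs
  rwa [show x + t • (c - x) + s • (y + t • (c - y) - (x + t • (c - x))) =
    x + s • (y - x) + t • (c - (x + s • (y - x))) by module] at this

/-- The first order Taylor estimate on all of `Ω`: the derivative of the chord estimate at an
end point of the segment. -/
theorem abs_sub_taylor_le {d : ℕ} {Ω : Set (E d)} (hconv : Convex ℝ Ω)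
    (hcomp : IsCompact Ω) (hint : (interior Ω).Nonempty) {f : E d → ℝ}
    (hf : DifferentiableOn ℝ f Ω) {L : ℝ} (hL : 0 ≤ L)
    (hweak : ∀ u : E d, ‖u‖ = 1 → ∃ w, IsWeakSecondDeriv Ω u f w ∧
      ∀ᵐ y ∂(volume.restrict Ω), |w y| ≤ L)
    {x y : E d} (hx : x ∈ Ω) (hy : y ∈ Ω) :
    |f y - f x - inner ℝ (gradientWithin f Ω x) (y - x)| ≤ L / 2 * ‖y - x‖ ^ 2 := by
  rw [inner_gradientWithin_left]
  have hmaps : Set.MapsTo (fun s : ℝ => x + s • (y - x)) (Set.Ioo (0 : ℝ) 1) Ω := fun s hs =>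
    hconv.add_smul_sub_mem hx hy (Set.Ioo_subset_Icc_self hs)
  have hlin : HasDerivWithinAt (fun s : ℝ => x + s • (y - x)) (y - x) (Set.Ioo 0 1) 0 := by
    have := ((hasDerivAt_id (0 : ℝ)).smul_const (y - x)).const_add x
    simpa using this.hasDerivWithinAt
  have hfd : HasFDerivWithinAt f (fderivWithin ℝ f Ω x) Ω (x + (0 : ℝ) • (y - x)) := by
    simpa using (hf x hx).hasFDerivWithinAt
  have hder := hfd.comp_hasDerivWithinAt (0 : ℝ) hlin hmaps
  rw [hasDerivWithinAt_iff_tendsto_slope' (by simp)] at hder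
  have hI : Set.Ioo (0 : ℝ) 1 ∈ 𝓝[>] (0 : ℝ) := Ioo_mem_nhdsGT zero_lt_one
  have hder' := hder.mono_left ((nhdsWithin_le_iff (t := Set.Ioo (0:ℝ) 1) (s := Set.Ioi 0)).2 hI)
  have l1 := (((tendsto_const_nhds (x := f y - f x)).sub hder')).abs
  have l2 : Tendsto (fun s : ℝ => L / 2 * ‖y - x‖ ^ 2 * (1 - s)) (𝓝[>] 0)
      (𝓝 (L / 2 * ‖y - x‖ ^ 2)) := by
    have : Tendsto (fun s : ℝ => L / 2 * ‖y - x‖ ^ 2 * (1 - s)) (𝓝 0)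
      (𝓝 (L / 2 * ‖y - x‖ ^ 2 * (1 - 0))) := Continuous.tendsto (by fun_prop) 0
    simpa using this.mono_left nhdsWithin_le_nhds
  refine le_of_tendsto_of_tendsto l1 l2 ?_
  filter_upwards [hI] with s hs
  have key := abs_sub_chord_le_of_mem hconv hcomp hint hf.continuousOn hL hweak hx hy
    (Set.Ioo_subset_Icc_self hs)
  have hs0 : 0 < s := hs.1
  simp only [slope_def_field, Function.comp, zero_smul, add_zero, sub_zero]
  have e : f y - f x - (f (x + s • (y - x)) - f x) / s =
      -(f (x + s • (y - x)) - ((1 - s) * f x + s * f y)) / s := by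
    field_simp
    ring
  rw [e, abs_div, abs_neg, abs_of_pos hs0, div_le_iff₀ hs0]
  linarith

/-! ### The function class -/

theorem IsWeakSecondDeriv.neg_direction {d : ℕ} {Ω : Set (E d)} {u : E d} {f w : E d → ℝ}
    (h : IsWeakSecondDeriv Ω u f w) : IsWeakSecondDeriv Ω (-u) f w := by
  refine ⟨h.1, fun φ hφ hc hs => ?_⟩
  rw [← h.2 φ hφ hc hs]
  congr 1
  funext x
  congr 1
  have d1 : DifferentiableAt ℝ (fun y => lineDeriv ℝ φ y u) x :=
    ((contDiff_lineDeriv hφ u).differentiable (by simp)) _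
  rw [lineDeriv_neg]
  simp_rw [lineDeriv_neg]
  rw [d1.fun_neg.lineDeriv_eq_fderiv, d1.lineDeriv_eq_fderiv, fderiv_fun_neg]
  simp

theorem IsWeakSecondDeriv.linear_comb {d : ℕ} {Ω : Set (E d)} (hcomp : IsCompact Ω) {u : E d}
    {f w g v : E d → ℝ} (hf : ContinuousOn f Ω) (hg : ContinuousOn g Ω)
    (h : IsWeakSecondDeriv Ω u f w) (h' : IsWeakSecondDeriv Ω u g v) (a b : ℝ) :
    IsWeakSecondDeriv Ω u (fun x => a * f x + b * g x) (fun x => a * w x + b * v x) := by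
  refine ⟨(h.1.smul a).add (h'.1.smul b), fun φ hφ hc hs => ?_⟩
  have hφ2 := contDiff_lineDeriv (contDiff_lineDeriv hφ u) u
  obtain ⟨B, hB⟩ := (hasCompactSupport_lineDeriv (contDiff_lineDeriv hφ u)
    (hasCompactSupport_lineDeriv hφ hc u) u).exists_bound_of_continuous hφ2.continuous
  have i1 : ∀ k : E d → ℝ, ContinuousOn k Ω → IntegrableOn
      (fun x => k x * lineDeriv ℝ (fun y => lineDeriv ℝ φ y u) x u) Ω := fun k hk =>
    (hk.integrableOn_compact hcomp).mul_bdd hφ2.continuous.aestronglyMeasurable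
      (Eventually.of_forall hB)
  obtain ⟨B', hB'⟩ := hc.exists_bound_of_continuous hφ.continuous
  have i2 : ∀ k : E d → ℝ, LocallyIntegrableOn k (interior Ω) → IntegrableOn
      (fun x => k x * φ x) Ω := by
    intro k hk
    have h1 : IntegrableOn k (tsupport φ) :=
      (hk.mono_set hs).integrableOn_isCompact hc
    have h2 : IntegrableOn (fun x => k x * φ x) (tsupport φ) :=
      h1.mul_bdd hφ.continuous.aestronglyMeasurable (Eventually.of_forall hB')
    refine Integrable.integrableOn ((integrableOn_iff_integrable_of_support_subset ?_).1 h2)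
    exact (Function.support_mul_subset_right _ _).trans (subset_tsupport φ)
  simp_rw [add_mul, mul_assoc]
  rw [integral_add ((i1 f hf).const_mul a) ((i1 g hg).const_mul b),
    integral_add ((i2 w h.1).const_mul a) ((i2 v h'.1).const_mul b)]
  simp_rw [integral_const_mul]
  rw [h.2 φ hφ hc hs, h'.2 φ hφ hc hs]

theorem eLpNorm_top_le_one_iff {α : Type*} [MeasurableSpace α] {μ : Measure α} {F : α → ℝ} :
    eLpNorm F ∞ μ ≤ 1 ↔ ∀ᵐ x ∂μ, |F x| ≤ 1 := by
  rw [eLpNorm_exponent_top]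
  constructor
  · intro h
    filter_upwards [ae_le_eLpNormEssSup (f := F) (μ := μ)] with x hx
    have := hx.trans h
    rwa [Real.enorm_eq_ofReal_abs, ENNReal.ofReal_le_one] at this
  · intro h
    simpa using eLpNormEssSup_le_of_ae_bound (f := F) (C := 1) h

/-- The class does not see `p`: averaging the constraints for the directions `u` and `-u`
cancels the first order term. -/
theorem exists_weakSecondDeriv_add_mul_le {d : ℕ} {Ω : Set (E d)} (hcomp : IsCompact Ω) {p q : ℝ}
    {f : E d → ℝ} (hf : f ∈ classW p q Ω) {u : E d} (hu : ‖u‖ = 1) :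
    ∃ w, IsWeakSecondDeriv Ω u f w ∧ ∀ᵐ x ∂(volume.restrict Ω), |w x + q * f x| ≤ 1 := by
  obtain ⟨w, hw, hw1⟩ := hf.2 u hu
  obtain ⟨v, hv, hv1⟩ := hf.2 (-u) (by rwa [norm_neg])
  have hv' := hv.neg_direction
  rw [neg_neg] at hv'
  refine ⟨fun x => 1 / 2 * w x + 1 / 2 * v x, ?_, ?_⟩
  · have := hw.linear_comb hcomp hf.1.continuousOn hf.1.continuousOn hv' (1 / 2) (1 / 2)
    rwa [show (fun x => 1 / 2 * f x + 1 / 2 * f x) = f by funext x; ring] at this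
  · rw [eLpNorm_top_le_one_iff] at hw1 hv1
    filter_upwards [hw1, hv1] with x h1 h2
    rw [inner_neg_right] at h2
    rw [abs_le] at *
    constructor <;> linarith [h1.1, h1.2, h2.1, h2.2]

theorem gradientWithin_half_sub {d : ℕ} {Ω : Set (E d)} (hconv : Convex ℝ Ω)
    (hint : (interior Ω).Nonempty) {f g : E d → ℝ} (hf : DifferentiableOn ℝ f Ω)
    (hg : DifferentiableOn ℝ g Ω) {x : E d} (hx : x ∈ Ω) :
    gradientWithin (fun x => 1 / 2 * f x + -(1 / 2) * g x) Ω x =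
      (1 / 2 : ℝ) • (gradientWithin f Ω x - gradientWithin g Ω x) := by
  have hu : UniqueDiffWithinAt ℝ Ω x := uniqueDiffOn_convex hconv hint x hx
  have h : HasFDerivWithinAt (fun x => 1 / 2 * f x + -(1 / 2) * g x)
      ((1 / 2 : ℝ) • fderivWithin ℝ f Ω x + (-(1 / 2) : ℝ) • fderivWithin ℝ g Ω x) Ω x :=
    ((hf x hx).hasFDerivWithinAt.const_mul (1 / 2)).add
      ((hg x hx).hasFDerivWithinAt.const_mul (-(1 / 2)))
  unfold gradientWithin
  rw [h.fderivWithin hu, map_add, map_smulₛₗ, map_smulₛₗ]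
  simp only [conj_trivial]
  module

theorem half_sub_mem_classW {d : ℕ} {Ω : Set (E d)} (hconv : Convex ℝ Ω) (hcomp : IsCompact Ω)
    (hint : (interior Ω).Nonempty) {p q : ℝ} {f g : E d → ℝ} (hf : f ∈ classW p q Ω)
    (hg : g ∈ classW p q Ω) :
    (fun x => 1 / 2 * f x + -(1 / 2) * g x) ∈ classW p q Ω := by
  refine ⟨(contDiffOn_const.mul hf.1).add (contDiffOn_const.mul hg.1), fun u hu => ?_⟩
  obtain ⟨w, hw, hw1⟩ := hf.2 u hu
  obtain ⟨v, hv, hv1⟩ := hg.2 u hu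
  refine ⟨_, hw.linear_comb hcomp hf.1.continuousOn hg.1.continuousOn hv (1 / 2) (-(1 / 2)), ?_⟩
  rw [eLpNorm_top_le_one_iff] at *
  filter_upwards [hw1, hv1, ae_restrict_mem hcomp.isClosed.measurableSet] with x h1 h2 hx
  rw [gradientWithin_half_sub hconv hint (hf.1.differentiableOn one_ne_zero)
    (hg.1.differentiableOn one_ne_zero) hx, real_inner_smul_left, inner_sub_left]
  rw [abs_le] at *
  constructor <;> linarith [h1.1, h1.2, h2.1, h2.2]

theorem abs_sub_taylor_le_of_mem_classW {d : ℕ} {Ω : Set (E d)} (hconv : Convex ℝ Ω)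
    (hcomp : IsCompact Ω) (hint : (interior Ω).Nonempty) {p q : ℝ} {f : E d → ℝ}
    (hf : f ∈ classW p q Ω) {M : ℝ} (hM0 : 0 ≤ M) (hM : ∀ x ∈ Ω, |f x| ≤ M)
    {x y : E d} (hx : x ∈ Ω) (hy : y ∈ Ω) :
    |f y - f x - inner ℝ (gradientWithin f Ω x) (y - x)| ≤
      (1 + |q| * M) / 2 * ‖y - x‖ ^ 2 := by
  refine abs_sub_taylor_le hconv hcomp hint (hf.1.differentiableOn one_ne_zero)
    (by positivity) (fun u hu => ?_) hx hy
  obtain ⟨w, hw, hw1⟩ := exists_weakSecondDeriv_add_mul_le hcomp hf hu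
  refine ⟨w, hw, ?_⟩
  filter_upwards [hw1, ae_restrict_mem hcomp.isClosed.measurableSet] with z hz hzΩ
  have h1 : |q * f z| ≤ |q| * M := by
    rw [abs_mul]
    exact mul_le_mul_of_nonneg_left (hM z hzΩ) (abs_nonneg q)
  calc |w z| = |(w z + q * f z) - q * f z| := by ring_nf
    _ ≤ |w z + q * f z| + |q * f z| := abs_sub _ _
    _ ≤ 1 + |q| * M := add_le_add hz h1

/-- A member of the class with vanishing information at nodes that are `ε`-dense in `Ω` and
`ε/√2`-dense on its boundary. At an interior maximum point of `|f|` the gradient vanishes, and the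
second order estimates from that point and from the nearest node to the midpoint between them give
`2 · (ε/2)² / 2 = ε²/4` times the bound `1 + |q| max |f|` on the second derivative; at a boundary
maximum point the estimate from the nearest node gives `(ε/√2)² / 2`, which is the same. -/
theorem abs_le_of_info_eq_zero {d : ℕ} {Ω : Set (E d)} (hconv : Convex ℝ Ω) (hcomp : IsCompact Ω)
    (hint : (interior Ω).Nonempty) {p q ε : ℝ} {ξ : Set (E d)} (hξ : ξ ⊆ Ω)
    (hcov : ∀ x ∈ Ω, ∃ y ∈ ξ, ‖x - y‖ ≤ ε)
    (hfr : ∀ x ∈ frontier Ω, ∃ y ∈ ξ, ‖x - y‖ ^ 2 ≤ ε ^ 2 / 2)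
    (hε : |q| * (ε ^ 2 / 4) < 1) {f : E d → ℝ} (hf : f ∈ classW p q Ω)
    (h0 : ∀ x ∈ ξ, f x = 0 ∧ gradientWithin f Ω x = 0) :
    ∀ x ∈ Ω, |f x| ≤ (ε ^ 2 / 4) / (1 - |q| * (ε ^ 2 / 4)) := by
  obtain ⟨x₀, hx₀, hmax⟩ := hcomp.exists_isMaxOn (hint.mono interior_subset)
    hf.1.continuousOn.abs
  have hM : ∀ x ∈ Ω, |f x| ≤ |f x₀| := fun x hx => hmax hx
  have taylor := fun {x y : E d} (hx : x ∈ Ω) (hy : y ∈ Ω) =>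
    abs_sub_taylor_le_of_mem_classW hconv hcomp hint hf (abs_nonneg _) hM hx hy
  set M := |f x₀| with hMdef
  have hLpos : 0 ≤ 1 + |q| * M := by positivity
  have key : M ≤ (1 + |q| * M) * (ε ^ 2 / 4) := by
    by_cases hin : x₀ ∈ interior Ω
    · obtain ⟨y, hy, hyε⟩ := hcov x₀ hx₀
      have hyΩ := hξ hy
      have hgrad : gradientWithin f Ω x₀ = 0 := by
        have hn : Ω ∈ 𝓝 x₀ := mem_interior_iff_mem_nhds.1 hin
        have hfd : fderivWithin ℝ f Ω x₀ = 0 := by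
          rw [fderivWithin_of_mem_nhds hn]
          rcases abs_choice (f x₀) with hc | hc
          · have : IsLocalMax f x₀ := by
              filter_upwards [hn] with z hz
              rw [← hc]
              exact (le_abs_self _).trans (hM z hz)
            exact this.fderiv_eq_zero
          · have : IsLocalMin f x₀ := by
              filter_upwards [hn] with z hz
              have := (neg_le_abs (f z)).trans (hM z hz)
              rw [hMdef, hc] at this
              linarith
            exact this.fderiv_eq_zero
        simp [gradientWithin, hfd]
      set m := midpoint ℝ x₀ y with hm
      have hmΩ : m ∈ Ω := hconv.midpoint_mem hx₀ hyΩ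
      have t1 := taylor hx₀ hmΩ
      have t2 := taylor hyΩ hmΩ
      have n1 : ‖m - x₀‖ = ‖x₀ - y‖ / 2 := by
        rw [← dist_eq_norm, hm, dist_midpoint_left, dist_eq_norm]
        norm_num
        ring
      have n2 : ‖m - y‖ = ‖x₀ - y‖ / 2 := by
        rw [← dist_eq_norm, hm, dist_midpoint_right, dist_eq_norm]
        norm_num
        ring
      rw [hgrad, inner_zero_left, sub_zero, n1] at t1
      rw [(h0 y hy).1, (h0 y hy).2, inner_zero_left, sub_zero, sub_zero, n2] at t2
      have hsq : ‖x₀ - y‖ ^ 2 ≤ ε ^ 2 := pow_le_pow_left₀ (norm_nonneg _) hyε 2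
      have tri : M ≤ |f m - f x₀| + |f m| := by
        have := abs_sub (f m) (f m - f x₀)
        rw [sub_sub_cancel] at this
        linarith
      have := mul_le_mul_of_nonneg_left hsq hLpos
      nlinarith
    · obtain ⟨y, hy, hyε⟩ := hfr x₀ ⟨subset_closure hx₀, hin⟩
      have t := taylor (hξ hy) hx₀
      rw [(h0 y hy).1, (h0 y hy).2, inner_zero_left, sub_zero, sub_zero] at t
      have := mul_le_mul_of_nonneg_left hyε hLpos
      linarith
  intro x hx
  refine (hM x hx).trans ?_
  rw [le_div_iff₀ (by linarith)]
  linarith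

/-- Bounded members of the class are uniformly Lipschitz: the Taylor estimate bounds the gradient
on `Ω - x`, which contains a ball of fixed radius. -/
theorem exists_lipschitz_bound {d : ℕ} {Ω : Set (E d)} (hconv : Convex ℝ Ω) (hcomp : IsCompact Ω)
    (hint : (interior Ω).Nonempty) (p q : ℝ) {r : ℝ} (hr : 0 ≤ r) :
    ∃ K : ℝ, ∀ f ∈ classW p q Ω, (∀ x ∈ Ω, |f x| ≤ r) →
      ∀ x ∈ Ω, ∀ y ∈ Ω, |f y - f x| ≤ K * ‖y - x‖ := by
  obtain ⟨c, hc⟩ := hint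
  obtain ⟨ρ, hρ, hball⟩ := Metric.isOpen_iff.1 isOpen_interior c hc
  obtain ⟨D, hD⟩ := hcomp.isBounded.exists_norm_le
  have hD0 : 0 ≤ D := (norm_nonneg c).trans (hD c (interior_subset hc))
  have hdist : ∀ x ∈ Ω, ∀ y ∈ Ω, ‖y - x‖ ≤ 2 * D := fun x hx y hy =>
    (norm_sub_le y x).trans (by linarith [hD x hx, hD y hy])
  set L := 1 + |q| * r with hL
  have hL0 : 0 ≤ L := by positivity
  set A := 2 * r + L / 2 * (2 * D) ^ 2 with hA
  have hA0 : 0 ≤ A := by positivity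
  refine ⟨A / (ρ / 2) + L / 2 * (2 * D), fun f hf hfr x hx y hy => ?_⟩
  have taylor := fun {y : E d} (hy : y ∈ Ω) =>
    abs_sub_taylor_le_of_mem_classW hconv hcomp ⟨c, hc⟩ hf hr hfr hx hy
  set g := gradientWithin f Ω x with hg
  have hin : ∀ y ∈ Ω, |inner ℝ g (y - x)| ≤ A := by
    intro y hy
    have h1 := taylor hy
    have h2 : L / 2 * ‖y - x‖ ^ 2 ≤ L / 2 * (2 * D) ^ 2 :=
      mul_le_mul_of_nonneg_left (pow_le_pow_left₀ (norm_nonneg _) (hdist x hx y hy) 2)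
        (by positivity)
    have h3 := hfr x hx
    have h4 := hfr y hy
    rw [abs_le] at *
    constructor <;> linarith [h1.1, h1.2, h3.1, h3.2, h4.1, h4.2]
  have hgn : ‖g‖ ≤ A / (ρ / 2) := by
    rw [le_div_iff₀ (half_pos hρ)]
    rcases eq_or_ne g 0 with h0 | h0
    · simpa [h0] using hA0
    have hgpos : 0 < ‖g‖ := norm_pos_iff.2 h0
    set e := (ρ / 2) • (‖g‖⁻¹ • g) with he
    have hen : ‖e‖ = ρ / 2 := by
      rw [he, norm_smul, norm_smul, norm_inv, norm_norm, inv_mul_cancel₀ hgpos.ne', mul_one,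
        Real.norm_of_nonneg (half_pos hρ).le]
    have m1 : c + e ∈ Ω := interior_subset (hball (by simp [hen, hρ]))
    have m2 : c - e ∈ Ω := interior_subset (hball (by simp [hen, hρ]))
    have i1 := hin _ m1
    have i2 := hin _ m2
    have hie : inner ℝ g e = ‖g‖ * (ρ / 2) := by
      rw [he, inner_smul_right, inner_smul_right, real_inner_self_eq_norm_sq]
      field_simp
    rw [show c + e - x = (c - x) + e by abel, inner_add_right, hie] at i1
    rw [show c - e - x = (c - x) - e by abel, inner_sub_right, hie] at i2
    rw [abs_le] at i1 i2
    linarith [i1.2, i2.1]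
  have h1 := taylor hy
  have h2 : L / 2 * ‖y - x‖ ^ 2 ≤ L / 2 * (2 * D) * ‖y - x‖ := by
    rw [pow_two, ← mul_assoc]
    refine mul_le_mul_of_nonneg_right ?_ (norm_nonneg _)
    exact mul_le_mul_of_nonneg_left (hdist x hx y hy) (by positivity)
  have h3 : |inner ℝ g (y - x)| ≤ A / (ρ / 2) * ‖y - x‖ :=
    (abs_real_inner_le_norm _ _).trans (mul_le_mul_of_nonneg_right hgn (norm_nonneg _))
  rw [abs_le] at *
  constructor <;> linarith [h1.1, h1.2, h3.1, h3.2]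

/-! ### The central algorithm -/

/-- Chebyshev centre: a family of functions with pairwise distances at most `2 r`, whose
differences from one continuous member are uniformly Lipschitz, lies within `r` of a continuous
function, namely of the mean of its upper and lower envelopes. -/
theorem exists_continuous_center {X : Type*} [PseudoMetricSpace X] {S : Set (X → ℝ)} {r K : ℝ}
    {f₀ : X → ℝ} (hf₀ : f₀ ∈ S) (hcont : Continuous f₀)
    (hdist : ∀ f ∈ S, ∀ g ∈ S, ∀ x, |f x - g x| ≤ 2 * r)
    (hlip : ∀ f ∈ S, ∀ x y, |(f y - f₀ y) - (f x - f₀ x)| ≤ K * dist x y) :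
    ∃ c : C(X, ℝ), ∀ f ∈ S, ∀ x, |f x - c x| ≤ r := by
  have : Nonempty S := ⟨⟨f₀, hf₀⟩⟩
  have ba : ∀ x, BddAbove (Set.range fun f : S => f.1 x - f₀ x) := fun x =>
    ⟨2 * r, by rintro _ ⟨f, rfl⟩; exact (abs_le.1 (hdist f f.2 f₀ hf₀ x)).2⟩
  have bb : ∀ x, BddBelow (Set.range fun f : S => f.1 x - f₀ x) := fun x =>
    ⟨-(2 * r), by rintro _ ⟨f, rfl⟩; exact (abs_le.1 (hdist f f.2 f₀ hf₀ x)).1⟩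
  set a : X → ℝ := fun x => ⨆ f : S, (f.1 x - f₀ x) with ha
  set b : X → ℝ := fun x => ⨅ f : S, (f.1 x - f₀ x) with hb
  have ca : Continuous a := by
    refine (LipschitzWith.of_le_add_mul (Real.toNNReal K) fun x y => ?_).continuous
    refine ciSup_le fun f => ?_
    have h1 := (abs_le.1 (hlip f f.2 x y)).1
    have h2 := le_ciSup (ba y) f
    have h3 := mul_le_mul_of_nonneg_right (Real.le_coe_toNNReal K) (dist_nonneg (x := x) (y := y))
    simp only [ha] at *
    linarith
  have cb : Continuous b := by
    refine (LipschitzWith.of_le_add_mul (Real.toNNReal K) fun x y => ?_).continuous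
    rw [← sub_le_iff_le_add]
    refine le_ciInf fun f => ?_
    have h1 := (abs_le.1 (hlip f f.2 x y)).1
    have h2 := ciInf_le (bb x) f
    have h3 := mul_le_mul_of_nonneg_right (Real.le_coe_toNNReal K) (dist_nonneg (x := x) (y := y))
    simp only [hb] at *
    linarith
  have hab : ∀ x, a x ≤ b x + 2 * r := fun x => by
    refine ciSup_le fun f => ?_
    rw [← sub_le_iff_le_add]
    refine le_ciInf fun g => ?_
    have := (abs_le.1 (hdist f f.2 g g.2 x)).2
    linarith
  refine ⟨⟨fun x => f₀ x + (a x + b x) / 2, by fun_prop⟩, fun f hf x => ?_⟩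
  have h1 : f x - f₀ x ≤ a x := le_ciSup (ba x) ⟨f, hf⟩
  have h2 : b x ≤ f x - f₀ x := ciInf_le (bb x) ⟨f, hf⟩
  have h3 := hab x
  simp only [ContinuousMap.coe_mk]
  rw [abs_le]
  constructor <;> linarith

theorem nodeError_le {d : ℕ} {Ω : Set (E d)} (hconv : Convex ℝ Ω) (hcomp : IsCompact Ω)
    (hint : (interior Ω).Nonempty) {p q ε : ℝ} {ξ : Finset (E d)} (hξ : (ξ : Set (E d)) ⊆ Ω)
    (hcov : ∀ x ∈ Ω, ∃ y ∈ ξ, ‖x - y‖ ≤ ε)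
    (hfr : ∀ x ∈ frontier Ω, ∃ y ∈ ξ, ‖x - y‖ ^ 2 ≤ ε ^ 2 / 2)
    (hε : |q| * (ε ^ 2 / 4) < 1) :
    nodeError Ω (classW p q Ω) ξ ≤
      ENNReal.ofReal ((ε ^ 2 / 4) / (1 - |q| * (ε ^ 2 / 4))) := by
  set r := (ε ^ 2 / 4) / (1 - |q| * (ε ^ 2 / 4)) with hr
  have hr0 : 0 ≤ r := div_nonneg (by positivity) (by linarith)
  obtain ⟨K, hK⟩ := exists_lipschitz_bound hconv hcomp hint p q hr0
  have half : ∀ f ∈ classW p q Ω, ∀ g ∈ classW p q Ω, info Ω ξ f = info Ω ξ g →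
      (fun x => 1 / 2 * f x + -(1 / 2) * g x) ∈ classW p q Ω ∧
        ∀ x ∈ Ω, |1 / 2 * f x + -(1 / 2) * g x| ≤ r := by
    intro f hf g hg hfg
    have hmem := half_sub_mem_classW hconv hcomp hint hf hg
    refine ⟨hmem, abs_le_of_info_eq_zero hconv hcomp hint hξ hcov hfr hε hmem fun x hx => ?_⟩
    have hx' := congrFun hfg ⟨x, hx⟩
    simp only [info, Prod.mk.injEq] at hx'
    rw [gradientWithin_half_sub hconv hint (hf.1.differentiableOn one_ne_zero)
      (hg.1.differentiableOn one_ne_zero) (hξ hx), hx'.1, hx'.2]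
    constructor
    · ring
    · simp
  have center : ∀ I : ξ → ℝ × E d, ∃ c : C(Ω, ℝ), ∀ f ∈ classW p q Ω, info Ω ξ f = I →
      ∀ x : Ω, |f x - c x| ≤ r := by
    intro I
    by_cases hI : ∃ f₀ ∈ classW p q Ω, info Ω ξ f₀ = I
    · obtain ⟨f₀, hf₀, hI₀⟩ := hI
      obtain ⟨c, hc⟩ := exists_continuous_center (X := Ω) (r := r) (K := 2 * K)
        (S := {F | ∃ f ∈ classW p q Ω, info Ω ξ f = I ∧ F = fun x : Ω => f x})
        (f₀ := fun x : Ω => f₀ x) ⟨f₀, hf₀, hI₀, rfl⟩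
        (continuousOn_iff_continuous_domRestrict.1 hf₀.1.continuousOn)
        (by
          rintro _ ⟨f, hf, hfI, rfl⟩ _ ⟨g, hg, hgI, rfl⟩ x
          have := (half f hf g hg (hfI.trans hgI.symm)).2 x x.2
          rw [abs_le] at *
          constructor <;> linarith [this.1, this.2])
        (by
          rintro _ ⟨f, hf, hfI, rfl⟩ x y
          have h := half f hf f₀ hf₀ (hfI.trans hI₀.symm)
          have := hK _ h.1 h.2 x x.2 y y.2
          rw [dist_comm, Subtype.dist_eq, dist_eq_norm]
          rw [abs_le] at *
          constructor <;> linarith [this.1, this.2])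
      exact ⟨c, fun f hf hfI x => hc _ ⟨f, hf, hfI, rfl⟩ x⟩
    · exact ⟨0, fun f hf hfI => absurd ⟨f, hf, hfI⟩ hI⟩
  choose A hA using center
  refine (iInf_le _ A).trans (iSup₂_le fun f hf => ?_)
  rw [eLpNorm_exponent_top]
  exact eLpNormEssSup_le_of_ae_bound (Eventually.of_forall fun x => hA _ f hf rfl x)

/-! ### Grids and coverings -/

theorem volume_box {d : ℕ} (l : Fin d → ℝ) {s : ℝ} :
    volume {x : E d | ∀ i, x i ∈ Set.Ico (l i) (l i + s)} = ENNReal.ofReal s ^ d := by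
  have h : {x : E d | ∀ i, x i ∈ Set.Ico (l i) (l i + s)} =
      (MeasurableEquiv.toLp 2 (Fin d → ℝ)).symm ⁻¹'
        (Set.univ.pi fun i => Set.Ico (l i) (l i + s)) := by
    ext x
    simp [Set.mem_pi]
  rw [h, (EuclideanSpace.volume_preserving_symm_measurableEquiv_toLp (Fin d)).measure_preimage_equiv,
    Real.volume_pi_Ico]
  simp

theorem volume_cube (d : ℕ) (R : ℝ) : volume (cube d R) = ENNReal.ofReal (2 * R) ^ d := by
  have h : cube d R =
      (MeasurableEquiv.toLp 2 (Fin d → ℝ)).symm ⁻¹' (Set.Icc (fun _ => -R) (fun _ => R)) := by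
    ext x
    simp [cube, Set.mem_Icc, Pi.le_def, forall_and]
  rw [h, (EuclideanSpace.volume_preserving_symm_measurableEquiv_toLp (Fin d)).measure_preimage_equiv,
    Real.volume_Icc_pi]
  simp [two_mul]

theorem volume_closedBall_eq {d : ℕ} (c : E d) {r : ℝ} (hr : 0 ≤ r) :
    volume (Metric.closedBall c r) =
      ENNReal.ofReal r ^ d * volume (Metric.ball (0 : E d) 1) := by
  rw [Measure.addHaar_closedBall volume c hr, finrank_euclideanSpace_fin, ENNReal.ofReal_pow hr]

/-- The index of the half-open cube of the grid `s ℤ^d` that contains `x`. -/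
noncomputable def gridIndex {d : ℕ} (s : ℝ) (x : E d) : Fin d → ℤ := fun i => ⌊x i / s⌋

theorem mem_box_iff_gridIndex_eq {d : ℕ} {s : ℝ} (hs : 0 < s) (x : E d) (k : Fin d → ℤ) :
    gridIndex s x = k ↔ ∀ i, x i ∈ Set.Ico (k i * s) (k i * s + s) := by
  rw [funext_iff]
  refine forall_congr' fun i => ?_
  rw [gridIndex, Int.floor_eq_iff, Set.mem_Ico, le_div_iff₀ hs, div_lt_iff₀ hs, add_mul, one_mul]

theorem norm_sub_le_of_gridIndex_eq {d : ℕ} {s : ℝ} (hs : 0 < s) {x y : E d}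
    (h : gridIndex s x = gridIndex s y) : ‖x - y‖ ≤ d * s := by
  have hx := (mem_box_iff_gridIndex_eq hs x _).1 h
  have hy := (mem_box_iff_gridIndex_eq hs y _).1 rfl
  rw [EuclideanSpace.norm_eq]
  refine Real.sqrt_le_iff.2 ⟨by positivity, ?_⟩
  have h1 : ∀ i, ‖(x - y) i‖ ^ 2 ≤ s ^ 2 := by
    intro i
    refine pow_le_pow_left₀ (norm_nonneg _) ?_ 2
    rw [PiLp.sub_apply, Real.norm_eq_abs, abs_le]
    have := hx i
    have := hy i
    simp only [Set.mem_Ico] at *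
    constructor <;> linarith
  calc ∑ i, ‖(x - y) i‖ ^ 2 ≤ ∑ _i : Fin d, s ^ 2 := Finset.sum_le_sum fun i _ => h1 i
    _ = d * s ^ 2 := by simp
    _ ≤ (d * s) ^ 2 := by
        rw [mul_pow]
        refine mul_le_mul_of_nonneg_right ?_ (by positivity)
        rcases Nat.eq_zero_or_pos d with h0 | h0
        · simp [h0]
        · have : (1 : ℝ) ≤ d := by exact_mod_cast h0
          nlinarith

/-- The grid cubes that meet `K` are disjoint and contained in a thickening of `K`. -/
theorem finite_gridIndex_image {d : ℕ} {s : ℝ} (hs : 0 < s) {K : Set (E d)}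
    (hK : volume (Metric.cthickening (d * s) K) ≠ ⊤) :
    (gridIndex s '' K).Finite ∧
      ((gridIndex s '' K).ncard : ℝ) * s ^ d ≤ volume.real (Metric.cthickening (d * s) K) := by
  have hcell : ∀ k : Fin d → ℤ, {x : E d | gridIndex s x = k} =
      {x : E d | ∀ i, x i ∈ Set.Ico (k i * s) (k i * s + s)} := fun k => by
    ext x
    exact mem_box_iff_gridIndex_eq hs x k
  have hvol : ∀ k : Fin d → ℤ, volume {x : E d | gridIndex s x = k} = ENNReal.ofReal s ^ d :=
    fun k => by rw [hcell, volume_box]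
  have hmeas : ∀ k : Fin d → ℤ, MeasurableSet {x : E d | gridIndex s x = k} := by
    intro k
    rw [hcell, Set.ofPred_forall]
    exact MeasurableSet.iInter fun i =>
      measurableSet_Ico.preimage (by fun_prop : Measurable fun x : E d => x i)
  have hF : ∀ F : Finset (Fin d → ℤ), (F : Set (Fin d → ℤ)) ⊆ gridIndex s '' K →
      (F.card : ℝ≥0∞) * ENNReal.ofReal s ^ d ≤ volume (Metric.cthickening (d * s) K) := by
    intro F hF
    have hdisj : (F : Set (Fin d → ℤ)).PairwiseDisjoint
        (fun k => {x : E d | gridIndex s x = k}) := by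
      intro k _ l _ hkl
      refine Set.disjoint_left.2 fun x hx hx' => hkl ?_
      exact hx.symm.trans hx'
    calc (F.card : ℝ≥0∞) * ENNReal.ofReal s ^ d
        = ∑ k ∈ F, volume {x : E d | gridIndex s x = k} := by simp [hvol]
      _ = volume (⋃ k ∈ F, {x : E d | gridIndex s x = k}) :=
          (measure_biUnion_finset hdisj fun k _ => hmeas k).symm
      _ ≤ _ := by
          refine measure_mono (Set.iUnion₂_subset fun k hk x hx => ?_)
          obtain ⟨y, hy, rfl⟩ := hF hk
          refine Metric.mem_cthickening_of_dist_le x y _ _ hy ?_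
          rw [dist_eq_norm]
          exact norm_sub_le_of_gridIndex_eq hs hx
  have hs0 : ENNReal.ofReal s ^ d ≠ 0 := pow_ne_zero _ (ENNReal.ofReal_pos.2 hs).ne'
  have hfin : (gridIndex s '' K).Finite := by
    by_contra hinf
    obtain ⟨n, hn⟩ := ENNReal.exists_nat_mul_gt hs0 hK
    obtain ⟨F, hFs, hFc⟩ := Set.Infinite.exists_subset_card_eq hinf n
    have := hF F hFs
    rw [hFc] at this
    exact absurd this (not_le.2 hn)
  refine ⟨hfin, ?_⟩
  have h := hF hfin.toFinset (by simp)
  rw [← Set.ncard_eq_toFinset_card _ hfin] at h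
  have h' := ENNReal.toReal_mono hK h
  simpa [ENNReal.toReal_mul, ENNReal.toReal_pow, ENNReal.toReal_ofReal hs.le, Measure.real]
    using h'

/-- Every covering of the space has density at least `1`, by countable subadditivity. -/
theorem one_le_dens (d : ℕ) : 1 ≤ dens d := by
  refine le_iInf fun r => le_iInf fun C => le_iInf fun hr => le_iInf fun hC => le_iInf fun hU => ?_
  refine le_liminf_of_le (by isBoundedDefault) ?_
  filter_upwards [eventually_gt_atTop 0] with R hR
  have hv : volume (cube d R) = ENNReal.ofReal (2 * R) ^ d := volume_cube d R
  have h0 : volume (cube d R) ≠ 0 := by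
    rw [hv]
    exact pow_ne_zero _ (ENNReal.ofReal_pos.2 (by positivity)).ne'
  have ht : volume (cube d R) ≠ ⊤ := by
    rw [hv]
    exact ENNReal.pow_ne_top ENNReal.ofReal_ne_top
  rw [ENNReal.le_div_iff_mul_le (Or.inl h0) (Or.inl ht), one_mul]
  have : Countable C := hC.to_subtype
  calc volume (cube d R) ≤ volume (⋃ c : C, Metric.closedBall (c : E d) r ∩ cube d R) := by
        refine measure_mono fun x hx => ?_
        have : x ∈ ⋃ c ∈ C, Metric.closedBall c r := hU ▸ Set.mem_univ x
        simp only [Set.mem_iUnion] at this ⊢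
        obtain ⟨c, hc, hxc⟩ := this
        exact ⟨⟨c, hc⟩, hxc, hx⟩
    _ ≤ _ := measure_iUnion_le _

/-- A covering of nearly minimal density yields an economical covering of one cube by unit balls:
take the balls that lie inside a large cube `[-R, R]^d`; they cover `[-R + 2r, R - 2r]^d`. -/
theorem exists_cover_box {d : ℕ} {D : ℝ} (hD : dens d < ENNReal.ofReal D) :
    ∃ a : ℝ, 0 < a ∧ ∃ F : Finset (E d),
      (∀ x : E d, (∀ i, x i ∈ Set.Icc 0 a) → ∃ c ∈ F, ‖x - c‖ ≤ 1) ∧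
      (F.card : ℝ) * volume.real (Metric.ball (0 : E d) 1) ≤ D * a ^ d := by
  obtain ⟨D', hD1, hD2⟩ := exists_between hD
  lift D' to NNReal using hD2.ne_top
  have hDpos : 0 < D := ENNReal.ofReal_pos.1 (pos_of_gt hD)
  have hD2' : (D' : ℝ) < D := by
    have := (ENNReal.lt_ofReal_iff_toReal_lt ENNReal.coe_ne_top).1 hD2
    simpa using this
  simp only [dens, iInf_lt_iff] at hD1
  obtain ⟨r, C, hr, hC, hU, hlt⟩ := hD1
  have hfreq := frequently_lt_of_liminf_lt (by isBoundedDefault) hlt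
  have hev : ∀ᶠ R : ℝ in atTop, (D' : ℝ) * (2 * R) ^ d ≤ D * (2 * (R - 2 * r)) ^ d := by
    have hl : Tendsto (fun R : ℝ => D * (1 - 2 * r * R⁻¹) ^ d) atTop (𝓝 (D * (1 - 2 * r * 0) ^ d)) :=
      (((tendsto_inv_atTop_zero.const_mul (2 * r)).const_sub 1).pow d).const_mul D
    have hlt' : (D' : ℝ) < D * (1 - 2 * r * 0) ^ d := by simpa using hD2'
    filter_upwards [hl.eventually (lt_mem_nhds hlt'), eventually_gt_atTop 0] with R h1 hR
    have e : 2 * (R - 2 * r) = (1 - 2 * r * R⁻¹) * (2 * R) := by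
      field_simp
    rw [e, mul_pow (1 - 2 * r * R⁻¹), ← mul_assoc]
    exact mul_le_mul_of_nonneg_right h1.le (by positivity)
  obtain ⟨R, hR1, hR2, hR3⟩ :=
    (hfreq.and_eventually (hev.and (eventually_gt_atTop (2 * r)))).exists
  have hRpos : 0 < R := by linarith
  have hv : volume (cube d R) = ENNReal.ofReal (2 * R) ^ d := volume_cube d R
  have h0 : volume (cube d R) ≠ 0 := by
    rw [hv]
    exact pow_ne_zero _ (ENNReal.ofReal_pos.2 (by positivity)).ne'
  have ht : volume (cube d R) ≠ ⊤ := by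
    rw [hv]
    exact ENNReal.pow_ne_top ENNReal.ofReal_ne_top
  have hsum : ∑' c : C, volume (Metric.closedBall (c : E d) r ∩ cube d R) ≤
      D' * volume (cube d R) := by
    rw [ENNReal.div_lt_iff (Or.inl h0) (Or.inl ht)] at hR1
    exact hR1.le
  set β := volume (Metric.closedBall (0 : E d) r) with hβ
  have hβ0 : β ≠ 0 := (Metric.measure_closedBall_pos volume _ hr).ne'
  -- the centres whose balls lie inside the cube
  set T : Set C := {c | Metric.closedBall (c : E d) r ⊆ cube d R} with hT
  have hG : ∀ G : Finset C, (G : Set C) ⊆ T → (G.card : ℝ≥0∞) * β ≤ D' * volume (cube d R) := by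
    intro G hG
    refine le_trans ?_ hsum
    refine le_trans (le_of_eq ?_) (ENNReal.sum_le_tsum G)
    rw [Finset.sum_congr rfl (g := fun _ => β), Finset.sum_const, nsmul_eq_mul]
    intro c hc
    rw [Set.inter_eq_left.2 (hG hc), volume_closedBall_eq _ hr.le, hβ,
      volume_closedBall_eq _ hr.le]
  have htop : (D' : ℝ≥0∞) * volume (cube d R) ≠ ⊤ := ENNReal.mul_ne_top ENNReal.coe_ne_top ht
  have hTfin : T.Finite := by
    by_contra hinf
    obtain ⟨n, hn⟩ := ENNReal.exists_nat_mul_gt hβ0 htop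
    obtain ⟨G, hGs, hGc⟩ := Set.Infinite.exists_subset_card_eq hinf n
    have := hG G hGs
    rw [hGc] at this
    exact absurd this (not_le.2 hn)
  have hcard := hG hTfin.toFinset (by simp)
  set ν := volume.real (Metric.ball (0 : E d) 1) with hν
  have hcard' : (hTfin.toFinset.card : ℝ) * (r ^ d * ν) ≤ D' * (2 * R) ^ d := by
    have h' := ENNReal.toReal_mono htop hcard
    rw [hβ, volume_closedBall_eq _ hr.le, hv] at h'
    simp only [ENNReal.toReal_mul, ENNReal.toReal_pow, ENNReal.toReal_ofReal hr.le,
      ENNReal.toReal_ofReal (by positivity : (0 : ℝ) ≤ 2 * R), ENNReal.toReal_natCast,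
      ENNReal.coe_toReal] at h'
    exact h'
  set b := R - 2 * r with hb
  have hbpos : 0 < b := by linarith
  set o : E d := WithLp.toLp 2 (fun _ => b) with ho
  classical
  refine ⟨2 * b / r, by positivity, hTfin.toFinset.image fun c : C => r⁻¹ • ((c : E d) + o), ?_, ?_⟩
  · intro x hx
    have hmem : r • x - o ∈ ⋃ c ∈ C, Metric.closedBall c r := hU ▸ Set.mem_univ _
    simp only [Set.mem_iUnion] at hmem
    obtain ⟨c, hc, hxc⟩ := hmem
    rw [mem_closedBall_iff_norm] at hxc
    have hcT : (⟨c, hc⟩ : C) ∈ T := by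
      intro z hz i
      rw [mem_closedBall_iff_norm] at hz
      have h1 := (PiLp.norm_apply_le (r • x - o - c) i).trans hxc
      have h2 := (PiLp.norm_apply_le (z - c) i).trans hz
      have h3 := hx i
      rw [Set.mem_Icc, le_div_iff₀ hr] at h3
      simp only [PiLp.sub_apply, PiLp.smul_apply, smul_eq_mul, ho, Real.norm_eq_abs, abs_le] at h1 h2
      have h4 : 0 ≤ r * x i := mul_nonneg hr.le h3.1
      rw [Set.mem_Icc]
      constructor <;> linarith [h1.1, h1.2, h2.1, h2.2, h3.2]
    refine ⟨r⁻¹ • (c + o), Finset.mem_image.2 ⟨⟨c, hc⟩, hTfin.mem_toFinset.2 hcT, rfl⟩, ?_⟩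
    rw [show x - r⁻¹ • (c + o) = r⁻¹ • (r • x - o - c) by
      rw [smul_sub, smul_sub, smul_smul, inv_mul_cancel₀ hr.ne', one_smul]; module,
      norm_smul, norm_inv, Real.norm_of_nonneg hr.le, inv_mul_le_iff₀ hr, mul_one]
    exact hxc
  · have hc1 : ((hTfin.toFinset.image fun c : C => r⁻¹ • ((c : E d) + o)).card : ℝ) ≤
        hTfin.toFinset.card := by exact_mod_cast Finset.card_image_le
    have hνnn : 0 ≤ ν := measureReal_nonneg
    have h1 := (hcard'.trans hR2)
    rw [div_pow, ← mul_div_assoc, le_div_iff₀ (by positivity)]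
    calc _ ≤ (hTfin.toFinset.card : ℝ) * ν * r ^ d := by gcongr
      _ = (hTfin.toFinset.card : ℝ) * (r ^ d * ν) := by ring
      _ ≤ _ := h1

theorem exists_proj {d : ℕ} {Ω : Set (E d)} (hconv : Convex ℝ Ω) (hcomp : IsCompact Ω)
    (hne : Ω.Nonempty) (c : E d) : ∃ y ∈ Ω, ∀ x ∈ Ω, ‖x - y‖ ≤ ‖x - c‖ := by
  obtain ⟨y, hy, hmin⟩ := exists_norm_eq_iInf_of_complete_convex hne hcomp.isComplete hconv c
  refine ⟨y, hy, fun x hx => ?_⟩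
  have h := (norm_eq_iInf_iff_real_inner_le_zero hconv hy).1 hmin x hx
  have e : ‖x - c‖ ^ 2 = ‖x - y‖ ^ 2 - 2 * inner ℝ (c - y) (x - y) + ‖c - y‖ ^ 2 := by
    rw [show x - c = (x - y) - (c - y) by abel, norm_sub_sq_real, real_inner_comm]
  refine (sq_le_sq₀ (norm_nonneg _) (norm_nonneg _)).1 ?_
  nlinarith [sq_nonneg ‖c - y‖]

/-- A convex body is covered by `ε`-balls centred in it, with a number of balls that the density
and the volume of a thickening control. -/
theorem exists_cover_convex {d : ℕ} {Ω : Set (E d)} (hconv : Convex ℝ Ω) (hcomp : IsCompact Ω)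
    (hne : Ω.Nonempty) {a D ε : ℝ} (ha : 0 < a) (hε : 0 < ε) {F : Finset (E d)}
    (hF : ∀ x : E d, (∀ i, x i ∈ Set.Icc 0 a) → ∃ c ∈ F, ‖x - c‖ ≤ 1)
    (hcard : (F.card : ℝ) * volume.real (Metric.ball (0 : E d) 1) ≤ D * a ^ d) (hD : 0 ≤ D) :
    ∃ ξ : Finset (E d), (ξ : Set (E d)) ⊆ Ω ∧ (∀ x ∈ Ω, ∃ y ∈ ξ, ‖x - y‖ ≤ ε) ∧
      (ξ.card : ℝ) * (volume.real (Metric.ball (0 : E d) 1) * ε ^ d) ≤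
        D * volume.real (Metric.cthickening (d * (a * ε)) Ω) := by
  classical
  have hs : 0 < a * ε := by positivity
  obtain ⟨hfin, hI⟩ := finite_gridIndex_image hs (K := Ω)
    (hcomp.cthickening (r := d * (a * ε))).measure_lt_top.ne
  choose P hP1 hP2 using exists_proj hconv hcomp hne
  set corner : (Fin d → ℤ) → E d := fun k => WithLp.toLp 2 fun i => k i * (a * ε) with hcorner
  set ξ := (hfin.toFinset ×ˢ F).image fun kc => P (corner kc.1 + ε • kc.2) with hξ
  refine ⟨ξ, ?_, ?_, ?_⟩
  · intro y hy
    obtain ⟨kc, -, rfl⟩ := Finset.mem_image.1 (Finset.mem_coe.1 hy)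
    exact hP1 _
  · intro x hx
    set k := gridIndex (a * ε) x with hk
    have hbox := (mem_box_iff_gridIndex_eq hs x k).1 rfl
    obtain ⟨c, hc, hxc⟩ := hF (ε⁻¹ • (x - corner k)) (by
      intro i
      have h := hbox i
      rw [Set.mem_Ico] at h
      simp only [PiLp.sub_apply, PiLp.smul_apply, smul_eq_mul, hcorner, Set.mem_Icc]
      rw [inv_mul_le_iff₀ hε]
      refine ⟨mul_nonneg (inv_nonneg.2 hε.le) (by linarith [h.1]), by linarith [h.2]⟩)
    refine ⟨P (corner k + ε • c), Finset.mem_image.2 ⟨(k, c), ?_, rfl⟩, ?_⟩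
    · simp only [Finset.mem_product, Set.Finite.mem_toFinset]
      exact ⟨⟨x, hx, rfl⟩, hc⟩
    · refine (hP2 _ x hx).trans ?_
      rw [show x - (corner k + ε • c) = ε • (ε⁻¹ • (x - corner k) - c) by
        rw [smul_sub, smul_smul, mul_inv_cancel₀ hε.ne', one_smul]; abel,
        norm_smul, Real.norm_of_nonneg hε.le]
      exact mul_le_of_le_one_right hε.le hxc
  · have hνnn : 0 ≤ volume.real (Metric.ball (0 : E d) 1) := measureReal_nonneg
    have h1 : (ξ.card : ℝ) ≤ (gridIndex (a * ε) '' Ω).ncard * F.card := by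
      rw [Set.ncard_eq_toFinset_card _ hfin, hξ, ← Nat.cast_mul, ← Finset.card_product]
      exact_mod_cast Finset.card_image_le
    calc (ξ.card : ℝ) * (volume.real (Metric.ball (0 : E d) 1) * ε ^ d)
        ≤ ((gridIndex (a * ε) '' Ω).ncard * F.card) *
          (volume.real (Metric.ball (0 : E d) 1) * ε ^ d) := by gcongr
      _ = (gridIndex (a * ε) '' Ω).ncard * ε ^ d *
          (F.card * volume.real (Metric.ball (0 : E d) 1)) := by ring
      _ ≤ (gridIndex (a * ε) '' Ω).ncard * ε ^ d * (D * a ^ d) := by gcongr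
      _ = D * ((gridIndex (a * ε) '' Ω).ncard * (a * ε) ^ d) := by rw [mul_pow]; ring
      _ ≤ _ := by gcongr

theorem exists_net {d : ℕ} (hd : 1 ≤ d) {K : Set (E d)} (hK : IsCompact K) {δ : ℝ} (hδ : 0 < δ) :
    ∃ ξ : Finset (E d), (ξ : Set (E d)) ⊆ K ∧ (∀ x ∈ K, ∃ y ∈ ξ, ‖x - y‖ ≤ δ) ∧
      (ξ.card : ℝ) * δ ^ d ≤ (d : ℝ) ^ d * volume.real (Metric.cthickening δ K) := by
  classical
  have hd0 : (0 : ℝ) < d := by exact_mod_cast hd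
  have hs : 0 < δ / d := by positivity
  have e : d * (δ / d) = δ := by field_simp
  obtain ⟨hfin, hI⟩ := finite_gridIndex_image hs (K := K)
    (hK.cthickening (r := d * (δ / d))).measure_lt_top.ne
  have hsel : ∀ k : Fin d → ℤ, ∃ y : E d, k ∈ gridIndex (δ / d) '' K →
      y ∈ K ∧ gridIndex (δ / d) y = k := by
    intro k
    by_cases h : k ∈ gridIndex (δ / d) '' K
    · obtain ⟨y, hy, hyk⟩ := h
      exact ⟨y, fun _ => ⟨hy, hyk⟩⟩
    · exact ⟨0, fun h' => absurd h' h⟩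
  choose Y hY using hsel
  refine ⟨hfin.toFinset.image Y, ?_, ?_, ?_⟩
  · intro y hy
    obtain ⟨k, hk, rfl⟩ := Finset.mem_image.1 (Finset.mem_coe.1 hy)
    exact (hY k (by simpa using hk)).1
  · intro x hx
    have hk : gridIndex (δ / d) x ∈ gridIndex (δ / d) '' K := ⟨x, hx, rfl⟩
    refine ⟨Y (gridIndex (δ / d) x), Finset.mem_image.2 ⟨_, by simpa using hk, rfl⟩, ?_⟩
    have := norm_sub_le_of_gridIndex_eq hs (hY _ hk).2.symm
    rwa [e] at this
  · rw [e, div_pow, mul_div_assoc', div_le_iff₀ (by positivity)] at hI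
    have h1 : ((hfin.toFinset.image Y).card : ℝ) ≤ (gridIndex (δ / d) '' K).ncard := by
      rw [Set.ncard_eq_toFinset_card _ hfin]
      exact_mod_cast Finset.card_image_le
    calc _ ≤ ((gridIndex (δ / d) '' K).ncard : ℝ) * δ ^ d := by gcongr
      _ ≤ _ := by linarith

theorem tendsto_measureReal_cthickening {d : ℕ} {K : Set (E d)} (hK : IsCompact K) (t : ℝ) :
    Tendsto (fun ε : ℝ => volume.real (Metric.cthickening (t * ε) K)) (𝓝[>] 0)
      (𝓝 (volume.real K)) := by
  have h := tendsto_measure_cthickening_of_isCompact (μ := (volume : Measure (E d))) hK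
  have h2 := (ENNReal.tendsto_toReal hK.measure_lt_top.ne).comp h
  refine h2.comp ?_
  have : Tendsto (fun ε : ℝ => t * ε) (𝓝 0) (𝓝 (t * 0)) := Continuous.tendsto (by fun_prop) 0
  rw [mul_zero] at this
  exact this.mono_left nhdsWithin_le_nhds

/-- Node sets for the upper estimate: an economical `ε`-covering of `Ω` together with a finer net
on the boundary. The latter has `o(ε⁻ᵈ)` points, because the boundary of a convex set is null. -/
theorem eventually_exists_nodes {d : ℕ} (hd : 1 ≤ d) {Ω : Set (E d)} (hconv : Convex ℝ Ω)
    (hcomp : IsCompact Ω) (hne : Ω.Nonempty) {D B : ℝ} (hD : dens d < ENNReal.ofReal D)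
    (hB : D * volume.real Ω < B) :
    ∀ᶠ ε : ℝ in 𝓝[>] 0, ∃ ξ : Finset (E d), (ξ : Set (E d)) ⊆ Ω ∧
      (∀ x ∈ Ω, ∃ y ∈ ξ, ‖x - y‖ ≤ ε) ∧
      (∀ x ∈ frontier Ω, ∃ y ∈ ξ, ‖x - y‖ ^ 2 ≤ ε ^ 2 / 2) ∧
      (ξ.card : ℝ) * (volume.real (Metric.ball (0 : E d) 1) * ε ^ d) ≤ B := by
  classical
  have hDpos : 0 < D := ENNReal.ofReal_pos.1 (pos_of_gt hD)
  obtain ⟨a, ha, F, hF, hcard⟩ := exists_cover_box hD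
  have hfrc : IsCompact (frontier Ω) :=
    hcomp.of_isClosed_subset isClosed_frontier hcomp.isClosed.frontier_subset
  have hfr0 : volume.real (frontier Ω) = 0 := by
    rw [Measure.real, hconv.addHaar_frontier volume]
    rfl
  set ν := volume.real (Metric.ball (0 : E d) 1) with hν
  have hνnn : 0 ≤ ν := measureReal_nonneg
  have hlim := ((tendsto_measureReal_cthickening hcomp (d * a)).const_mul D).add
    ((tendsto_measureReal_cthickening hfrc (1 / 2)).const_mul (ν * 2 ^ d * (d : ℝ) ^ d))
  rw [hfr0, mul_zero, add_zero] at hlim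
  filter_upwards [hlim.eventually (gt_mem_nhds hB), self_mem_nhdsWithin] with ε hle hε
  rw [Set.mem_Ioi] at hε
  obtain ⟨ξ₁, hs1, hc1, hn1⟩ := exists_cover_convex hconv hcomp hne ha hε hF hcard hDpos.le
  obtain ⟨ξ₂, hs2, hc2, hn2⟩ := exists_net hd hfrc (half_pos hε)
  refine ⟨ξ₁ ∪ ξ₂, ?_, ?_, ?_, ?_⟩
  · rw [Finset.coe_union]
    exact Set.union_subset hs1 (hs2.trans hcomp.isClosed.frontier_subset)
  · intro x hx
    obtain ⟨y, hy, h⟩ := hc1 x hx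
    exact ⟨y, Finset.mem_union_left _ hy, h⟩
  · intro x hx
    obtain ⟨y, hy, h⟩ := hc2 x hx
    refine ⟨y, Finset.mem_union_right _ hy, ?_⟩
    have := pow_le_pow_left₀ (norm_nonneg _) h 2
    nlinarith [sq_nonneg ε]
  · have h1 : ((ξ₁ ∪ ξ₂).card : ℝ) ≤ ξ₁.card + ξ₂.card := by
      exact_mod_cast Finset.card_union_le _ _
    rw [← mul_assoc] at hn1
    have h3 : (ξ₂.card : ℝ) * (ν * ε ^ d) ≤
        ν * 2 ^ d * (d : ℝ) ^ d * volume.real (Metric.cthickening (1 / 2 * ε) (frontier Ω)) := by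
      rw [show 1 / 2 * ε = ε / 2 by ring]
      calc (ξ₂.card : ℝ) * (ν * ε ^ d) = ν * 2 ^ d * (ξ₂.card * (ε / 2) ^ d) := by
            rw [div_pow]
            field_simp
        _ ≤ ν * 2 ^ d * ((d : ℝ) ^ d * volume.real (Metric.cthickening (ε / 2) (frontier Ω))) := by
            gcongr
        _ = _ := by ring
    calc ((ξ₁ ∪ ξ₂).card : ℝ) * (ν * ε ^ d) ≤ (ξ₁.card + ξ₂.card) * (ν * ε ^ d) := by gcongr
      _ ≤ B := by
        rw [show (d : ℝ) * a * ε = d * (a * ε) by ring] at hle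
        rw [mul_assoc] at hn1
        linarith

/-! ### Asymptotics -/

/-- The estimate with `1 + o(1)` replaced by `θ · θ^(2/d)`, for any `θ > 1`: one factor pays for
the term `q f`, the other for the number of nodes. -/
theorem eventually_optError_le {d : ℕ} (hd : 1 ≤ d) {Ω : Set (E d)} (hconv : Convex ℝ Ω)
    (hcomp : IsCompact Ω) (hint : (interior Ω).Nonempty) (p q : ℝ) (hdens : dens d ≠ ⊤)
    {θ : ℝ} (hθ : 1 < θ) :
    ∀ᶠ n : ℕ in atTop, optError Ω (classW p q Ω) n ≤
      ENNReal.ofReal (θ * θ ^ (2 / (d : ℝ)) * (1 / 4 * ((dens d).toReal * volume.real Ω /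
        (volume.real (Metric.ball (0 : E d) 1) * n)) ^ (2 / (d : ℝ)))) := by
  have hd0 : (0 : ℝ) < d := by exact_mod_cast hd
  have hdnn : d ≠ 0 := by omega
  set ν := volume.real (Metric.ball (0 : E d) 1) with hν
  have hνpos : 0 < ν := ENNReal.toReal_pos
    (Metric.measure_ball_pos volume _ one_pos).ne' measure_ball_lt_top.ne
  have hμpos : 0 < volume.real Ω := ENNReal.toReal_pos
    (Measure.measure_pos_of_nonempty_interior volume hint).ne' hcomp.measure_lt_top.ne
  have hDpos : 0 < (dens d).toReal :=
    ENNReal.toReal_pos (zero_lt_one.trans_le (one_le_dens d)).ne' hdens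
  set D₀ := (dens d).toReal with hD₀
  obtain ⟨D, hD1, hD2⟩ := exists_between (show D₀ < θ * D₀ by nlinarith)
  have hdD : dens d < ENNReal.ofReal D := (ENNReal.lt_ofReal_iff_toReal_lt hdens).2 hD1
  set B := θ * D₀ * volume.real Ω with hB
  have hBpos : 0 < B := by positivity
  have hnodes := eventually_exists_nodes hd hconv hcomp (hint.mono interior_subset) hdD
    (mul_lt_mul_of_pos_right hD2 hμpos)
  -- for small `ε` the factor that comes from the term `q f` is at most `θ`
  have hsmall : ∀ᶠ ε : ℝ in 𝓝[>] 0, |q| * (ε ^ 2 / 4) < 1 - θ⁻¹ := by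
    have hl : Tendsto (fun ε : ℝ => |q| * (ε ^ 2 / 4)) (𝓝 0) (𝓝 (|q| * ((0 : ℝ) ^ 2 / 4))) :=
      Continuous.tendsto (by fun_prop) 0
    refine (hl.mono_left nhdsWithin_le_nhds).eventually (gt_mem_nhds ?_)
    have := inv_lt_one_of_one_lt₀ hθ
    norm_num
    exact this
  -- the radius for which the bound on the number of nodes equals `n`
  have hε : Tendsto (fun n : ℕ => (B / (ν * n)) ^ (1 / (d : ℝ))) atTop (𝓝[>] 0) := by
    refine tendsto_nhdsWithin_iff.2 ⟨?_, ?_⟩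
    · have h1 : Tendsto (fun n : ℕ => B / (ν * n)) atTop (𝓝 0) :=
        Tendsto.div_atTop tendsto_const_nhds
          (tendsto_natCast_atTop_atTop.const_mul_atTop hνpos)
      have h2 := h1.rpow_const (p := 1 / (d : ℝ)) (Or.inr (by positivity))
      rwa [Real.zero_rpow (by positivity)] at h2
    · filter_upwards [eventually_gt_atTop 0] with n hn
      have : (0 : ℝ) < n := by exact_mod_cast hn
      exact Real.rpow_pos_of_pos (by positivity) _
  filter_upwards [hε.eventually hnodes, hε.eventually hsmall, eventually_gt_atTop 0]
    with n hn1 hn2 hn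
  have hn0 : (0 : ℝ) < n := by exact_mod_cast hn
  have hbase : 0 ≤ B / (ν * n) := by positivity
  set ε := (B / (ν * n)) ^ (1 / (d : ℝ)) with hεdef
  obtain ⟨ξ, hξ, hcov, hfr, hcard⟩ := hn1
  have hεd : ε ^ d = B / (ν * n) := by
    rw [hεdef, one_div, Real.rpow_inv_natCast_pow hbase hdnn]
  have hε2 : ε ^ 2 = θ ^ (2 / (d : ℝ)) * (D₀ * volume.real Ω / (ν * n)) ^ (2 / (d : ℝ)) := by
    rw [← Real.mul_rpow (by positivity) (by positivity), hεdef, ← Real.rpow_natCast,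
      ← Real.rpow_mul hbase, hB]
    congr 1
    · ring
    · push_cast
      ring
  have hcard' : ξ.card ≤ n := by
    rw [hεd, show ν * (B / (ν * n)) = B / n by field_simp, ← mul_div_assoc,
      div_le_iff₀ hn0, mul_comm B] at hcard
    exact_mod_cast le_of_mul_le_mul_right hcard hBpos
  have hθinv : 0 < θ⁻¹ := by positivity
  refine (iInf_le_of_le ξ (iInf_le_of_le hξ (iInf_le _ hcard'))).trans ?_
  refine (nodeError_le hconv hcomp hint hξ hcov hfr (by linarith)).trans ?_
  refine ENNReal.ofReal_le_ofReal ?_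
  rw [show θ * θ ^ (2 / (d : ℝ)) * (1 / 4 * (D₀ * volume.real Ω / (ν * n)) ^ (2 / (d : ℝ))) =
    θ * (ε ^ 2 / 4) by rw [hε2]; ring]
  rw [div_le_iff₀ (by linarith)]
  have h1 : 1 ≤ θ * (1 - |q| * (ε ^ 2 / 4)) := by
    have : θ * θ⁻¹ ≤ θ * (1 - |q| * (ε ^ 2 / 4)) :=
      mul_le_mul_of_nonneg_left (by linarith) (by positivity)
    rwa [mul_inv_cancel₀ (by positivity)] at this
  have := mul_le_mul_of_nonneg_left h1 (by positivity : 0 ≤ ε ^ 2 / 4)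
  linarith

/-- If `a n ≤ (1 + η) b n` eventually for every `η > 0`, then `a n ≤ (1 + o(1)) b n`. -/
theorem exists_tendsto_zero_of_eventually_le {a : ℕ → ℝ≥0∞} {b : ℕ → ℝ}
    (hb : ∀ᶠ n in atTop, 0 < b n)
    (h : ∀ η > 0, ∀ᶠ n in atTop, a n ≤ ENNReal.ofReal ((1 + η) * b n)) :
    ∃ δ : ℕ → ℝ, Tendsto δ atTop (𝓝 0) ∧
      ∀ᶠ n in atTop, a n ≤ ENNReal.ofReal (b n) * ENNReal.ofReal (1 + δ n) := by
  refine ⟨fun n => max 0 ((a n).toReal / b n - 1), ?_, ?_⟩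
  · rw [Metric.tendsto_nhds]
    intro η hη
    filter_upwards [hb, h (η / 2) (half_pos hη)] with n hbn hn
    rw [Real.dist_eq, sub_zero, abs_of_nonneg (le_max_left _ _)]
    refine max_lt hη ?_
    have h1 := ENNReal.toReal_mono ENNReal.ofReal_ne_top hn
    rw [ENNReal.toReal_ofReal (by positivity), ← div_le_iff₀ hbn] at h1
    linarith
  · filter_upwards [hb, h 1 one_pos] with n hbn hn
    rw [← ENNReal.ofReal_mul hbn.le]
    refine ENNReal.le_ofReal_iff_toReal_le (ne_top_of_le_ne_top ENNReal.ofReal_ne_top hn)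
      (by positivity) |>.2 ?_
    have h1 : (a n).toReal / b n ≤ 1 + max 0 ((a n).toReal / b n - 1) := by
      linarith [le_max_right 0 ((a n).toReal / b n - 1)]
    rw [div_le_iff₀ hbn] at h1
    linarith

end OptRecovery

theorem theorem1 (d : ℕ) (hd : 1 ≤ d) (Ω : Set (OptRecovery.E d))
    (hconv : Convex ℝ Ω) (hclosed : IsClosed Ω) (hbdd : Bornology.IsBounded Ω)
    (hint : (interior Ω).Nonempty) (p q : ℝ) :
    ∃ δ : ℕ → ℝ, Tendsto δ atTop (𝓝 0) ∧
      ∀ᶠ n : ℕ in atTop,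
        OptRecovery.optError Ω (OptRecovery.classW p q Ω) n ≤
          1 / 4 *
            (OptRecovery.dens d * volume Ω /
              (volume (Metric.ball (0 : OptRecovery.E d) 1) * (n : ℝ≥0∞))) ^ (2 / (d : ℝ)) *
            ENNReal.ofReal (1 + δ n) := by
  have hcomp : IsCompact Ω := Metric.isCompact_of_isClosed_isBounded hclosed hbdd
  have hd0 : (0 : ℝ) < d := by exact_mod_cast hd
  have hμ0 : volume Ω ≠ 0 := (Measure.measure_pos_of_nonempty_interior volume hint).ne'
  have hμt : volume Ω ≠ ⊤ := hcomp.measure_lt_top.ne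
  have hν0 : volume (Metric.ball (0 : OptRecovery.E d) 1) ≠ 0 :=
    (Metric.measure_ball_pos volume _ one_pos).ne'
  have hνt : volume (Metric.ball (0 : OptRecovery.E d) 1) ≠ ⊤ := measure_ball_lt_top.ne
  by_cases hdens : OptRecovery.dens d = ⊤
  · refine ⟨fun _ => 0, tendsto_const_nhds, Eventually.of_forall fun n => ?_⟩
    rw [hdens, ENNReal.top_mul hμ0,
      ENNReal.top_div_of_ne_top (ENNReal.mul_ne_top hνt (ENNReal.natCast_ne_top n)),
      ENNReal.top_rpow_of_pos (by positivity)]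
    simp [ENNReal.mul_top]
  have hD0 : OptRecovery.dens d ≠ 0 := (zero_lt_one.trans_le (OptRecovery.one_le_dens d)).ne'
  set b : ℕ → ℝ := fun n => 1 / 4 * ((OptRecovery.dens d).toReal * volume.real Ω /
    (volume.real (Metric.ball (0 : OptRecovery.E d) 1) * n)) ^ (2 / (d : ℝ)) with hb
  have hbase : ∀ n : ℕ, 0 < n → 0 < (OptRecovery.dens d).toReal * volume.real Ω /
      (volume.real (Metric.ball (0 : OptRecovery.E d) 1) * n) := by
    intro n hn
    have h1 : 0 < (OptRecovery.dens d).toReal := ENNReal.toReal_pos hD0 hdens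
    have h2 : 0 < volume.real Ω := ENNReal.toReal_pos hμ0 hμt
    have h3 : 0 < volume.real (Metric.ball (0 : OptRecovery.E d) 1) := ENNReal.toReal_pos hν0 hνt
    have h4 : (0 : ℝ) < n := by exact_mod_cast hn
    positivity
  have hbpos : ∀ᶠ n in atTop, 0 < b n := by
    filter_upwards [eventually_gt_atTop 0] with n hn
    exact mul_pos (by norm_num) (Real.rpow_pos_of_pos (hbase n hn) _)
  obtain ⟨δ, hδ, hle⟩ := OptRecovery.exists_tendsto_zero_of_eventually_le
    (a := fun n => OptRecovery.optError Ω (OptRecovery.classW p q Ω) n) hbpos (fun η hη => by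
    have hl : Tendsto (fun θ : ℝ => θ * θ ^ (2 / (d : ℝ))) (𝓝[>] 1) (𝓝 (1 * 1 ^ (2 / (d : ℝ)))) := by
      refine Tendsto.mono_left ?_ nhdsWithin_le_nhds
      exact tendsto_id.mul (tendsto_id.rpow_const (Or.inl one_ne_zero))
    rw [Real.one_rpow, one_mul] at hl
    obtain ⟨θ, hθ1, hθ⟩ := ((hl.eventually (gt_mem_nhds (show (1 : ℝ) < 1 + η by linarith))).and
      self_mem_nhdsWithin).exists
    filter_upwards [OptRecovery.eventually_optError_le hd hconv hcomp hint p q hdens hθ, hbpos]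
      with n hn hbn
    exact hn.trans (ENNReal.ofReal_le_ofReal (mul_le_mul_of_nonneg_right hθ1.le hbn.le)))
  refine ⟨δ, hδ, ?_⟩
  filter_upwards [hle, eventually_gt_atTop 0] with n hn hn0
  refine hn.trans (le_of_eq ?_)
  congr 1
  have hn' : (0 : ℝ) < n := by exact_mod_cast hn0
  have h3 : 0 < volume.real (Metric.ball (0 : OptRecovery.E d) 1) := ENNReal.toReal_pos hν0 hνt
  have quarter : ENNReal.ofReal (1 / 4) = 1 / 4 := by
    rw [ENNReal.ofReal_div_of_pos (by norm_num)]
    simp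
  rw [hb, ENNReal.ofReal_mul (by norm_num), quarter, ← ENNReal.ofReal_rpow_of_pos (hbase n hn0),
    ENNReal.ofReal_div_of_pos (by positivity), ENNReal.ofReal_mul ENNReal.toReal_nonneg,
    ENNReal.ofReal_mul measureReal_nonneg, ENNReal.ofReal_toReal hdens,
    ofReal_measureReal hμt, ofReal_measureReal hνt, ENNReal.ofReal_natCast]
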